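/- Let $k\ge 0$, $\theta>0$, $\lambda>0$ and $4\le p<6$. Let $H^1(\mathbb R)=W^{1,2}(\mathbb R)$ be the Sobolev space of complex-valued functions, with norm $\|u\|^2=\int_{\mathbb R}(|u'|^2+|u|^2)\,dx$ (derivatives in the weak sense), and put $$I(u)=\int_{\mathbb R}\Big[\tfrac12|u'|^2+\tfrac k4\big|(|u|^2)'\big|^2-\tfrac{\theta}{p}|u|^p\Big]dx,\qquad \mathcal M=\Big\{u\in H^1(\mathbb R):\ \tfrac12\int_{\mathbb R}|u|^2\,dx=\lambda\Big\},\qquad m=\inf_{u\in\mathcal M}I(u).$$ Then: (i) $-\infty<m<0$. (ii) $m$ is attained by a nonnegative function: there is $0\ne w\in\mathcal M$ with $w\ge 0$ and $I(w)=m$. (iii) Every minimizing sequence converges, up to a subsequence and translations: if $u_n\in\mathcal M$ and $I(u_n)\to m$, then there are a subsequence $(u_{n_j})$, points $y_j\in\mathbb R$ and $w\in\mathcal M$ with $I(w)=m$ such that $\|u_{n_j}(\cdot+y_j)-w\|\to 0$ as $j\to\infty$. -/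

import Mathlib

open scoped ContDiff
open MeasureTheory Filter Topology

noncomputable section

namespace QuasilinearNLS

variable {E : Type*} [NormedAddCommGroup E] [NormedSpace ℝ E]

/-- `g` is a weak (distributional) first derivative of `u` on `ℝ`: both are locally integrable and
`∫ φ' u = - ∫ φ g` for every test function `φ ∈ C_c^∞(ℝ)`. -/
def IsWeakDeriv (u g : ℝ → E) : Prop :=
  LocallyIntegrable u volume ∧ LocallyIntegrable g volume ∧
    ∀ φ : ℝ → ℝ, ContDiff ℝ ∞ φ → HasCompactSupport φ →
      ∫ x, deriv φ x • u x = - ∫ x, φ x • g x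

open Classical in
/-- The weak derivative of `u`, determined up to a null set; it is set to `0` if `u` has no
locally integrable weak derivative. -/
def weakDeriv (u : ℝ → E) : ℝ → E :=
  if h : ∃ g, IsWeakDeriv u g then h.choose else 0

/-- Membership in `H¹(ℝ) = W^{1,2}(ℝ)` (complex valued): `u` and its weak derivative are in `L²`. -/
def MemH1 (u : ℝ → ℂ) : Prop :=
  MemLp u 2 volume ∧ ∃ g : ℝ → ℂ, MemLp g 2 volume ∧ IsWeakDeriv u g

/-- The norm of `H¹(ℝ)`: `‖u‖² = ∫ (|u'|² + |u|²)`. -/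
def h1Norm (u : ℝ → ℂ) : ℝ :=
  Real.sqrt (∫ x, (‖weakDeriv u x‖ ^ 2 + ‖u x‖ ^ 2))

/-- `I(u) = ∫ [ ½|u'|² + (k/4)|(|u|²)'|² - (θ/p)|u|^p ]`. -/
def energy (k θ p : ℝ) (u : ℝ → ℂ) : ℝ :=
  ∫ x, ((1 / 2) * ‖weakDeriv u x‖ ^ 2
    + (k / 4) * |weakDeriv (fun y => ‖u y‖ ^ 2) x| ^ 2
    - (θ / p) * ‖u x‖ ^ p)

/-- The constraint set `M = {u ∈ H¹(ℝ) : ½ ∫ |u|² = lam}`. -/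
def massSphere (lam : ℝ) : Set (ℝ → ℂ) :=
  {u | MemH1 u ∧ (1 / 2) * ∫ x, ‖u x‖ ^ 2 = lam}

/-- `m = inf {I(u) : u ∈ M}`. -/
def minEnergy (k θ p lam : ℝ) : ℝ :=
  sInf (energy k θ p '' massSphere lam)

end QuasilinearNLS

end

/-!
A minimizing sequence is bounded in `H¹`, since for `p < 6` the Gagliardo–Nirenberg inequality puts
the potential term below the kinetic one. As `m < 0`, which spreading out a fixed profile shows, the
sequence cannot vanish uniformly, so after translations and passing to a subsequence it converges,
pointwise and weakly in `H¹`, to some `w ≠ 0`.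

Let `ν` be the energy per unit mass at the infimum. Dilations turn the definition of `m` into the
statement that the action, which is the energy minus `ν` times the mass, is nonnegative on functions
of mass at most that of the sphere, and that a nonzero function with nonpositive action has at
least that mass. Cut the line at two points where `w` is small. The action of the sequence tends to
`0`; its outer parts are bounded below by small boundary terms, because a half-line restriction can
be completed by an exponential tail to a function to which nonnegativity of the action applies; and
its middle part is weakly lower semicontinuous. Hence the action of `w` is nonpositive, `w` carries
the full mass, and no mass or kinetic energy is lost in the limit, which makes the convergence
strong. The norm of a minimizer is again a minimizer.
-/

noncomputable section

namespace QuasilinearNLS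

section Primitives

/-! ### Primitives of locally integrable functions -/

variable {E : Type*} [NormedAddCommGroup E]

theorem intervalIntegrable_of_locallyIntegrable {g : ℝ → E} (hg : LocallyIntegrable g) (a b : ℝ) :
    IntervalIntegrable g volume a b :=
  intervalIntegrable_iff.mpr <|
    (hg.integrableOn_isCompact isCompact_uIcc).mono_set Set.uIoc_subset_uIcc

theorem absolutelyContinuousOnInterval_of_dist_le {X Y : Type*} [PseudoMetricSpace X]
    [PseudoMetricSpace Y] {f : ℝ → X} {g : ℝ → Y} {a b : ℝ}
    (hg : AbsolutelyContinuousOnInterval g a b)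
    (h : ∀ x y, dist (f x) (f y) ≤ dist (g x) (g y)) : AbsolutelyContinuousOnInterval f a b :=
  squeeze_zero (fun _ => Finset.sum_nonneg fun _ _ => dist_nonneg)
    (fun _ => Finset.sum_le_sum fun _ _ => h _ _) hg

variable [NormedSpace ℝ E] {u v g h : ℝ → E}

/-- `u` is a primitive of the locally integrable function `g`. These `u` are exactly the continuous
representatives of the functions with weak derivative `g`. -/
structure IsPrimitive (u g : ℝ → E) : Prop where
  locallyIntegrable : LocallyIntegrable g
  sub_eq : ∀ a b, u b - u a = ∫ x in a..b, g x

theorem isPrimitive_integral (hg : LocallyIntegrable g) (c : ℝ) :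
    IsPrimitive (fun x => ∫ t in c..x, g t) g :=
  ⟨hg, fun _ _ => intervalIntegral.integral_interval_sub_left
    (intervalIntegrable_of_locallyIntegrable hg _ _)
    (intervalIntegrable_of_locallyIntegrable hg _ _)⟩

theorem isPrimitive_of_hasDerivAt [CompleteSpace E] (hu : ∀ x, HasDerivAt u (g x) x)
    (hg : Continuous g) : IsPrimitive u g :=
  ⟨hg.locallyIntegrable, fun a b => (intervalIntegral.integral_eq_sub_of_hasDerivAt
    (fun x _ => hu x) (hg.intervalIntegrable a b)).symm⟩

namespace IsPrimitive

theorem intervalIntegrable (hu : IsPrimitive u g) (a b : ℝ) : IntervalIntegrable g volume a b :=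
  intervalIntegrable_of_locallyIntegrable hu.locallyIntegrable a b

theorem eq_add_integral (hu : IsPrimitive u g) (c : ℝ) :
    u = fun x => u c + ∫ t in c..x, g t := by
  ext x
  rw [← hu.sub_eq c x, add_sub_cancel]

theorem continuous (hu : IsPrimitive u g) : Continuous u := by
  rw [hu.eq_add_integral 0]
  exact continuous_const.add (intervalIntegral.continuous_primitive hu.intervalIntegrable 0)

theorem const_add (hu : IsPrimitive u g) (c : E) : IsPrimitive (fun x => c + u x) g :=
  ⟨hu.locallyIntegrable, fun a b => by rw [add_sub_add_left_eq_sub, hu.sub_eq]⟩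

theorem sub (hu : IsPrimitive u g) (hv : IsPrimitive v h) :
    IsPrimitive (fun x => u x - v x) (fun x => g x - h x) := by
  refine ⟨hu.locallyIntegrable.sub hv.locallyIntegrable, fun a b => ?_⟩
  rw [intervalIntegral.integral_sub (hu.intervalIntegrable a b) (hv.intervalIntegrable a b),
    ← hu.sub_eq, ← hv.sub_eq, sub_sub_sub_comm]

theorem glue {R : ℝ} (hu : IsPrimitive u g) (hv : IsPrimitive v h) (hR : u R = v R) :
    IsPrimitive (fun x => if x ≤ R then u x else v x) (fun x => if x ≤ R then g x else h x) := by
  have hloc : LocallyIntegrable (fun x => if x ≤ R then g x else h x) := by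
    convert! (hu.locallyIntegrable.indicator (measurableSet_Iic (a := R))).add
      (hv.locallyIntegrable.indicator (measurableSet_Ioi (a := R))) using 1
    ext x
    by_cases hx : x ≤ R <;> simp [Set.indicator, hx, not_lt.mpr, not_le.mp]
  have sub_eq_from_R (b : ℝ) : (if b ≤ R then u b else v b) - u R
      = ∫ x in R..b, (if x ≤ R then g x else h x) := by
    rcases le_or_gt b R with hb | hb
    · rw [if_pos hb, hu.sub_eq]
      refine intervalIntegral.integral_congr_ae (Eventually.of_forall fun x hx => ?_)
      rw [Set.uIoc_of_ge hb] at hx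
      rw [if_pos hx.2]
    · rw [if_neg hb.not_ge, hR, hv.sub_eq]
      refine intervalIntegral.integral_congr_ae (Eventually.of_forall fun x hx => ?_)
      rw [Set.uIoc_of_le hb.le] at hx
      rw [if_neg hx.1.not_ge]
  refine ⟨hloc, fun a b => ?_⟩
  rw [← intervalIntegral.integral_interval_sub_left
    (intervalIntegrable_of_locallyIntegrable hloc R b)
    (intervalIntegrable_of_locallyIntegrable hloc R a), ← sub_eq_from_R, ← sub_eq_from_R,
    sub_sub_sub_cancel_right]

theorem absolutelyContinuousOnInterval (hu : IsPrimitive u g) (a b : ℝ) :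
    AbsolutelyContinuousOnInterval u a b := by
  have h_ac := (hu.intervalIntegrable a b).norm.absolutelyContinuousOnInterval_intervalIntegral
    (c := a) (by simp)
  refine absolutelyContinuousOnInterval_of_dist_le h_ac fun x y => ?_
  rw [dist_comm, dist_eq_norm, hu.sub_eq, dist_comm, Real.dist_eq,
    intervalIntegral.integral_interval_sub_left (hu.intervalIntegrable _ _).norm
      (hu.intervalIntegrable _ _).norm]
  exact intervalIntegral.norm_integral_le_abs_integral_norm

theorem absolutelyContinuousOnInterval_norm (hu : IsPrimitive u g) (a b : ℝ) :
    AbsolutelyContinuousOnInterval (fun x => ‖u x‖) a b :=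
  absolutelyContinuousOnInterval_of_dist_le (hu.absolutelyContinuousOnInterval a b)
    fun x y => (dist_norm_norm_le (u x) (u y)).trans_eq (dist_eq_norm _ _).symm

theorem integral_eq_zero (hu : IsPrimitive u g) (hc : HasCompactSupport u) (hg : Integrable g) :
    ∫ x, g x = 0 := by
  have h_int := intervalIntegral_tendsto_integral hg tendsto_neg_atTop_atBot tendsto_id
  have h_diff : Tendsto (fun r : ℝ => u r - u (-r)) atTop (𝓝 0) := by
    have h_zero := hc.is_zero_at_infty
    simpa using (h_zero.mono_left atTop_le_cocompact).sub
      ((h_zero.mono_left atBot_le_cocompact).comp tendsto_neg_atTop_atBot)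
  exact tendsto_nhds_unique h_int (h_diff.congr fun r => hu.sub_eq (-r) r)

theorem ae_hasDerivAt [CompleteSpace E] (hu : IsPrimitive u g) :
    ∀ᵐ x, HasDerivAt u (g x) x := by
  filter_upwards [LocallyIntegrable.ae_hasDerivAt_integral hu.locallyIntegrable] with x hx
  rw [hu.eq_add_integral 0]
  exact (hx 0).const_add _

end IsPrimitive

theorem isPrimitive_of_absolutelyContinuous [CompleteSpace E]
    (hu : ∀ a b, AbsolutelyContinuousOnInterval u a b) (hg : LocallyIntegrable g)
    (hd : ∀ᵐ x, HasDerivAt u (g x) x) : IsPrimitive u g := by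
  refine ⟨hg, fun a b => ?_⟩
  have hp := isPrimitive_integral hg a
  have h_deriv : ∀ᵐ x, x ∈ Set.uIcc a b →
      HasDerivAt (u - fun x => ∫ t in a..x, g t) 0 x := by
    filter_upwards [hd, hp.ae_hasDerivAt] with x hux hpx _
    simpa only [sub_self] using hux.sub hpx
  obtain ⟨C, hC⟩ :=
    ((hu a b).sub (hp.absolutelyContinuousOnInterval a b)).const_of_ae_hasDerivAt_zero h_deriv
  have ha : u a = C := by simpa using hC a Set.left_mem_uIcc
  have hb : u b - ∫ t in a..b, g t = C := hC b Set.right_mem_uIcc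
  rw [ha, ← hb, sub_sub_cancel]

namespace IsPrimitive

theorem smul_contDiff [CompleteSpace E] (hu : IsPrimitive u g) {φ : ℝ → ℝ} (hφ : ContDiff ℝ 1 φ) :
    IsPrimitive (fun x => φ x • u x) (fun x => φ x • g x + deriv φ x • u x) := by
  refine isPrimitive_of_absolutelyContinuous (fun a b => ?_) ?_ ?_
  · exact hφ.contDiffOn.absolutelyContinuousOnInterval.fun_smul
      (hu.absolutelyContinuousOnInterval a b)
  · exact (hu.locallyIntegrable.continuous_smul hφ.continuous).add
      ((hφ.continuous_deriv le_rfl).smul hu.continuous).locallyIntegrable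
  · filter_upwards [hu.ae_hasDerivAt] with x hx
    exact (hφ.differentiable one_ne_zero x).hasDerivAt.smul hx

theorem exists_norm [CompleteSpace E] (hu : IsPrimitive u g) :
    ∃ r : ℝ → ℝ, IsPrimitive (fun x => ‖u x‖) r ∧ ∀ᵐ x, ‖r x‖ ≤ ‖g x‖ := by
  have h_diff : ∀ᵐ x, DifferentiableAt ℝ (fun x => ‖u x‖) x := by
    have h_all : ∀ᵐ x : ℝ, ∀ n : ℕ, x ∈ Set.uIcc (-n : ℝ) n →
        DifferentiableAt ℝ (fun x => ‖u x‖) x :=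
      ae_all_iff.mpr fun n => (hu.absolutelyContinuousOnInterval_norm _ _).ae_differentiableAt
    filter_upwards [h_all] with x hx
    obtain ⟨n, hn⟩ := exists_nat_ge |x|
    refine hx n ?_
    rw [Set.uIcc_of_le (by linarith [abs_nonneg x])]
    exact abs_le.mp hn
  have h_le : ∀ᵐ x, ‖deriv (fun x => ‖u x‖) x‖ ≤ ‖g x‖ := by
    filter_upwards [h_diff, hu.ae_hasDerivAt] with x hx hux
    refine le_of_tendsto_of_tendsto' (hasDerivAt_iff_tendsto_slope.mp hx.hasDerivAt).norm
      (hasDerivAt_iff_tendsto_slope.mp hux).norm fun y => ?_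
    simp only [slope, vsub_eq_sub, norm_smul]
    gcongr
    exact abs_norm_sub_norm_le _ _
  refine ⟨deriv (fun x => ‖u x‖), isPrimitive_of_absolutelyContinuous
    hu.absolutelyContinuousOnInterval_norm ?_ (h_diff.mono fun x hx => hx.hasDerivAt), h_le⟩
  exact hu.locallyIntegrable.mono (measurable_deriv _).aestronglyMeasurable h_le

theorem norm_sq {F : Type*} [NormedAddCommGroup F] [InnerProductSpace ℝ F] [CompleteSpace F]
    {u g : ℝ → F} (hu : IsPrimitive u g) :
    IsPrimitive (fun x => ‖u x‖ ^ 2) (fun x => 2 * inner ℝ (u x) (g x)) := by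
  refine isPrimitive_of_absolutelyContinuous (fun a b => ?_) ?_
    (hu.ae_hasDerivAt.mono fun x hx => hx.norm_sq)
  · simpa only [pow_two] using (hu.absolutelyContinuousOnInterval_norm a b).fun_mul
      (hu.absolutelyContinuousOnInterval_norm a b)
  · refine (hu.locallyIntegrable.continuous_smul (hu.continuous.norm.const_mul 2)).mono
      ((hu.continuous.aestronglyMeasurable.inner
        hu.locallyIntegrable.aestronglyMeasurable).const_mul 2) (Eventually.of_forall fun x => ?_)
    rw [norm_mul, norm_smul, norm_mul, norm_norm, mul_assoc]
    gcongr
    exact norm_inner_le_norm _ _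

end IsPrimitive

/-! ### Weak derivatives and primitives -/

theorem IsPrimitive.isWeakDeriv [CompleteSpace E] (hu : IsPrimitive u g) : IsWeakDeriv u g := by
  refine ⟨hu.continuous.locallyIntegrable, hu.locallyIntegrable, fun φ hφ hc => ?_⟩
  have hφ' : ContDiff ℝ 1 φ := hφ.of_le (by simp)
  have h_left : Integrable (fun x => φ x • g x) :=
    hu.locallyIntegrable.integrable_smul_left_of_hasCompactSupport hφ.continuous hc
  have h_right : Integrable (fun x => deriv φ x • u x) :=
    hu.continuous.locallyIntegrable.integrable_smul_left_of_hasCompactSupport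
      (hφ'.continuous_deriv le_rfl) hc.deriv
  have h_zero := (hu.smul_contDiff hφ').integral_eq_zero hc.smul_right (h_left.add h_right)
  rw [integral_add h_left h_right] at h_zero
  exact eq_neg_of_add_eq_zero_right h_zero

theorem exists_hasCompactSupport_deriv_eq [CompleteSpace E] {f : ℝ → E} (hf : ContDiff ℝ ∞ f)
    (hc : HasCompactSupport f) (h0 : ∫ x, f x = 0) :
    ∃ φ : ℝ → E, ContDiff ℝ ∞ φ ∧ HasCompactSupport φ ∧ deriv φ = f := by
  have hfi : Integrable f := hf.continuous.integrable_of_hasCompactSupport hc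
  set φ : ℝ → E := fun x => ∫ t in Set.Iic x, f t with hφ_def
  have h_deriv (x : ℝ) : HasDerivAt φ (f x) x := by
    have h_eq : φ = fun x => φ 0 + ∫ t in (0 : ℝ)..x, f t := by
      ext x
      rw [← intervalIntegral.integral_Iic_sub_Iic hfi.integrableOn hfi.integrableOn,
        add_sub_cancel]
    rw [h_eq]
    exact (hf.continuous.integral_hasStrictDerivAt 0 x).hasDerivAt.const_add _
  have h_deriv_eq : deriv φ = f := funext fun x => (h_deriv x).deriv
  refine ⟨φ, ?_, ?_, h_deriv_eq⟩
  · rw [contDiff_infty_iff_deriv, h_deriv_eq]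
    exact ⟨fun x => (h_deriv x).differentiableAt, hf⟩
  obtain ⟨R, hR⟩ := hc.isCompact.isBounded.subset_closedBall 0
  rw [Real.closedBall_eq_Icc, zero_sub, zero_add] at hR
  have h_out (t : ℝ) (ht : t ∉ Set.Icc (-R) R) : f t = 0 :=
    image_eq_zero_of_notMem_tsupport fun hmem => ht (hR hmem)
  refine HasCompactSupport.intro (isCompact_Icc (a := -R) (b := R)) fun x hx => ?_
  rcases not_and_or.mp hx with hlt | hlt
  · exact setIntegral_eq_zero_of_forall_eq_zero fun t ht =>
      h_out t fun hmem => hlt (hmem.1.trans ht)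
  · rw [hφ_def, ← h0]
    exact setIntegral_eq_integral_of_forall_compl_eq_zero fun t ht =>
      h_out t fun hmem => hlt ((not_le.mp ht).le.trans hmem.2)

namespace IsWeakDeriv

variable {g' : ℝ → E}

theorem congr (hu : IsWeakDeriv u g) (huv : u =ᵐ[volume] v) : IsWeakDeriv v g := by
  refine ⟨hu.1.congr huv, hu.2.1, fun φ hφ hc => ?_⟩
  rw [← hu.2.2 φ hφ hc]
  exact integral_congr_ae (huv.mono fun x hx => by simp only [hx])

theorem sub (hu : IsWeakDeriv u g) (hv : IsWeakDeriv v h) :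
    IsWeakDeriv (fun x => u x - v x) (fun x => g x - h x) := by
  refine ⟨hu.1.sub hv.1, hu.2.1.sub hv.2.1, fun φ hφ hc => ?_⟩
  have hφ' : Continuous (deriv φ) := hφ.continuous_deriv (by simp)
  simp only [smul_sub]
  rw [integral_sub (hu.1.integrable_smul_left_of_hasCompactSupport hφ' hc.deriv)
      (hv.1.integrable_smul_left_of_hasCompactSupport hφ' hc.deriv),
    integral_sub (hu.2.1.integrable_smul_left_of_hasCompactSupport hφ.continuous hc)
      (hv.2.1.integrable_smul_left_of_hasCompactSupport hφ.continuous hc),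
    hu.2.2 φ hφ hc, hv.2.2 φ hφ hc, neg_sub_neg, neg_sub]

variable [CompleteSpace E]

theorem ae_unique (hu : IsWeakDeriv u g) (hu' : IsWeakDeriv u g') : g =ᵐ[volume] g' := by
  refine ae_eq_of_integral_contDiff_smul_eq hu.2.1 hu'.2.1 fun φ hφ hc => ?_
  rw [← neg_inj, ← hu.2.2 φ hφ hc, hu'.2.2 φ hφ hc]

theorem weakDeriv_ae_eq (hu : IsWeakDeriv u g) : weakDeriv u =ᵐ[volume] g := by
  have hex : ∃ g, IsWeakDeriv u g := ⟨g, hu⟩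
  rw [weakDeriv, dif_pos hex]
  exact hex.choose_spec.ae_unique hu

/-- Testing against `η - (∫ η) ρ`, with `ρ` of integral one, shows `∫ η u = ∫ η · ∫ ρ u`. -/
theorem exists_ae_eq_const (hu : IsWeakDeriv u 0) : ∃ c, u =ᵐ[volume] fun _ => c := by
  obtain ⟨ψ⟩ : Nonempty (ContDiffBump (0 : ℝ)) := inferInstance
  set ρ : ℝ → ℝ := ψ.normed volume
  have hρ : ContDiff ℝ ∞ ρ := ψ.contDiff_normed
  have hρc : HasCompactSupport ρ := ψ.hasCompactSupport_normed
  refine ⟨∫ x, ρ x • u x, ae_eq_of_integral_contDiff_smul_eq hu.1 (locallyIntegrable_const _)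
    fun η hη hηc => ?_⟩
  have h_mean : ∫ x, (η x - (∫ y, η y) * ρ x) = 0 := by
    rw [integral_sub (hη.continuous.integrable_of_hasCompactSupport hηc)
      ((hρ.continuous.integrable_of_hasCompactSupport hρc).const_mul _), integral_const_mul,
      ψ.integral_normed, mul_one, sub_self]
  obtain ⟨φ, hφ, hφc, hφ'⟩ := exists_hasCompactSupport_deriv_eq
    (hη.sub (contDiff_const.mul hρ)) (hηc.sub hρc.mul_left) h_mean
  have h_test := hu.2.2 φ hφ hφc
  simp only [hφ', Pi.zero_apply, smul_zero, integral_zero, neg_zero, sub_smul, mul_smul] at h_test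
  rw [integral_sub (hu.1.integrable_smul_left_of_hasCompactSupport hη.continuous hηc)
    ((hu.1.integrable_smul_left_of_hasCompactSupport hρ.continuous hρc).fun_smul _),
    integral_smul, sub_eq_zero] at h_test
  rw [h_test, integral_smul_const]

theorem exists_isPrimitive (hu : IsWeakDeriv u g) : ∃ v, IsPrimitive v g ∧ u =ᵐ[volume] v := by
  have hp := isPrimitive_integral hu.2.1 0
  obtain ⟨c, hc⟩ := exists_ae_eq_const (u := fun x => u x - ∫ t in (0 : ℝ)..x, g t)
    (by simpa only [sub_self] using! hu.sub hp.isWeakDeriv)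
  exact ⟨_, hp.const_add c, hc.mono fun x hx => eq_add_of_sub_eq hx⟩

end IsWeakDeriv

end Primitives

section MeasureSpace

/-! ### Inequalities for integrals -/

variable {α E F : Type*} [MeasurableSpace α] {μ : Measure α} [NormedAddCommGroup E]
  [NormedAddCommGroup F]

theorem integrable_norm_mul_norm {u : α → E} {g : α → F} (hu : MemLp u 2 μ) (hg : MemLp g 2 μ) :
    Integrable (fun x => ‖u x‖ * ‖g x‖) μ :=
  hu.norm.integrable_mul hg.norm

theorem integral_norm_mul_norm_le {u : α → E} {g : α → F} (hu : MemLp u 2 μ) (hg : MemLp g 2 μ) :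
    ∫ x, ‖u x‖ * ‖g x‖ ∂μ ≤ √(∫ x, ‖u x‖ ^ 2 ∂μ) * √(∫ x, ‖g x‖ ^ 2 ∂μ) := by
  have h_holder := integral_mul_le_Lp_mul_Lq_of_nonneg (μ := μ) Real.HolderConjugate.two_two
    (f := fun x => ‖u x‖) (g := fun x => ‖g x‖)
    (Eventually.of_forall fun _ => norm_nonneg _) (Eventually.of_forall fun _ => norm_nonneg _)
    (by simpa using hu.norm) (by simpa using hg.norm)
  simpa [Real.sqrt_eq_rpow] using h_holder

theorem exists_ge_lt_of_integrable {f : ℝ → ℝ} (hf : Integrable f) {ε : ℝ} (hε : 0 < ε) (R : ℝ) :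
    ∃ x ≥ R, f x < ε := by
  by_contra! hcon
  have h_const : IntegrableOn (fun _ : ℝ => ε) (Set.Ioi R) := by
    refine Integrable.mono' hf.integrableOn aestronglyMeasurable_const ?_
    filter_upwards [ae_restrict_mem measurableSet_Ioi] with x hx
    rw [Real.norm_of_nonneg hε.le]
    exact hcon x (le_of_lt hx)
  simp [integrableOn_const_iff, hε.ne'] at h_const

theorem rpow_le_rpow_sub_two_mul_sq {a C p : ℝ} (hp : 2 ≤ p) (ha : 0 ≤ a) (hC : a ≤ C) :
    a ^ p ≤ C ^ (p - 2) * a ^ 2 := by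
  rcases ha.eq_or_lt with rfl | ha0
  · rw [Real.zero_rpow (by linarith), zero_pow two_ne_zero, mul_zero]
  · calc a ^ p = a ^ (p - 2) * a ^ 2 := by
          rw [← Real.rpow_natCast a 2, ← Real.rpow_add ha0]; norm_num
      _ ≤ C ^ (p - 2) * a ^ 2 := by gcongr

theorem integral_norm_sq_congr {u v : α → E} (huv : v =ᵐ[μ] u) :
    ∫ x, ‖v x‖ ^ 2 ∂μ = ∫ x, ‖u x‖ ^ 2 ∂μ :=
  integral_congr_ae (huv.mono fun x hx => by simp only [hx])

end MeasureSpace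

section AffineChange

variable {E : Type*} [NormedAddCommGroup E]

theorem integral_comp_mul_add [NormedSpace ℝ E] (f : ℝ → E) (a b : ℝ) :
    ∫ x, f (a * x + b) = |a|⁻¹ • ∫ x, f x := by
  rw [Measure.integral_comp_mul_left (fun y => f (y + b)) a, integral_add_right_eq_self, abs_inv]

theorem memLp_comp_mul_add {f : ℝ → E} {q : ENNReal} (hf : MemLp f q) {a : ℝ} (ha : a ≠ 0)
    (b : ℝ) : MemLp (fun x => f (a * x + b)) q := by
  have h_map : volume.map (fun x : ℝ => a * x + b) = ENNReal.ofReal |a⁻¹| • volume := by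
    have h_comp := Measure.map_map (μ := volume) (measurable_add_const b) (measurable_const_mul a)
    rw [Real.map_volume_mul_left ha, Measure.map_smul, map_add_right_eq_self] at h_comp
    exact h_comp.symm
  refine MemLp.comp_of_map ?_ (by fun_prop)
  rw [h_map]
  exact hf.smul_measure ENNReal.ofReal_ne_top

theorem integral_norm_sq_comp [NormedSpace ℝ E] (u : ℝ → E) (c a b : ℝ) :
    ∫ x, ‖c • u (a * x + b)‖ ^ 2 = c ^ 2 * |a|⁻¹ * ∫ x, ‖u x‖ ^ 2 := by
  simp only [norm_smul, mul_pow, Real.norm_eq_abs, sq_abs]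
  rw [integral_const_mul, integral_comp_mul_add (fun x => ‖u x‖ ^ 2), smul_eq_mul, mul_assoc]

theorem integral_norm_rpow_comp [NormedSpace ℝ E] (u : ℝ → E) (p c a b : ℝ) :
    ∫ x, ‖c • u (a * x + b)‖ ^ p = |c| ^ p * |a|⁻¹ * ∫ x, ‖u x‖ ^ p := by
  simp only [norm_smul, Real.norm_eq_abs, Real.mul_rpow (abs_nonneg c) (norm_nonneg _)]
  rw [integral_const_mul, integral_comp_mul_add (fun x => ‖u x‖ ^ p), smul_eq_mul, mul_assoc]

end AffineChange

section Pairs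

/-! ### Continuous representatives of `H¹` functions -/

/-- `u` is the continuous representative of an `H¹` function with weak derivative `g`. Carrying `g`
along avoids the choice hidden in `weakDeriv`. -/
structure H1Pair {E : Type*} [NormedAddCommGroup E] [NormedSpace ℝ E] (u g : ℝ → E) : Prop
    extends IsPrimitive u g where
  memLp : MemLp u 2
  memLp_deriv : MemLp g 2

namespace H1Pair

section Normed

variable {E : Type*} [NormedAddCommGroup E] [NormedSpace ℝ E] {u g v h : ℝ → E}

theorem integrable_sq (hu : H1Pair u g) : Integrable (fun x => ‖u x‖ ^ 2) :=
  hu.memLp.integrable_norm_pow two_ne_zero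

theorem integrable_deriv_sq (hu : H1Pair u g) : Integrable (fun x => ‖g x‖ ^ 2) :=
  hu.memLp_deriv.integrable_norm_pow two_ne_zero

theorem sub (hu : H1Pair u g) (hv : H1Pair v h) :
    H1Pair (fun x => u x - v x) (fun x => g x - h x) :=
  ⟨hu.toIsPrimitive.sub hv.toIsPrimitive, hu.memLp.sub hv.memLp,
    hu.memLp_deriv.sub hv.memLp_deriv⟩

theorem comp_mul_add (hu : H1Pair u g) (c : ℝ) {a : ℝ} (ha : a ≠ 0) (b : ℝ) :
    H1Pair (fun x => c • u (a * x + b)) (fun x => (c * a) • g (a * x + b)) := by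
  have hg := (memLp_comp_mul_add hu.memLp_deriv ha b).const_smul (c * a)
  refine ⟨⟨hg.locallyIntegrable one_le_two, fun s t => ?_⟩,
    (memLp_comp_mul_add hu.memLp ha b).const_smul c, hg⟩
  rw [intervalIntegral.integral_smul, mul_smul, intervalIntegral.smul_integral_comp_mul_add,
    ← hu.sub_eq, smul_sub]

theorem translate (hu : H1Pair u g) (y : ℝ) :
    H1Pair (fun x => u (x + y)) (fun x => g (x + y)) := by
  simpa using hu.comp_mul_add 1 one_ne_zero y

theorem reflect (hu : H1Pair u g) : H1Pair (fun x => u (-x)) (fun x => -g (-x)) := by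
  simpa using hu.comp_mul_add 1 (neg_ne_zero.mpr one_ne_zero) 0

theorem integral_sq_pos (hu : H1Pair u g) {x : ℝ} (hx : u x ≠ 0) : 0 < ∫ x, ‖u x‖ ^ 2 :=
  integral_pos_of_integrable_nonneg_nonzero (hu.continuous.norm.pow 2) hu.integrable_sq
    (fun _ => by positivity) (x := x) (by simpa using hx)

theorem memLp_smul (hu : H1Pair u g) {C : ℝ} (hC : ∀ x, ‖u x‖ ≤ C) {q : ℝ → ℝ} (hq : MemLp q 2) :
    MemLp (fun x => q x • u x) 2 := by
  refine MemLp.of_le_mul (c := C) hq (hq.1.smul hu.continuous.aestronglyMeasurable)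
    (Eventually.of_forall fun x => ?_)
  rw [norm_smul, mul_comm]
  gcongr
  exact hC x

end Normed

variable {F : Type*} [NormedAddCommGroup F] [InnerProductSpace ℝ F] [CompleteSpace F]
  {u g v : ℝ → F} {p C : ℝ}

/-- Agmon's inequality: integrate `(|u|²)' = 2⟪u, g⟫` from a point where `u` is small. -/
theorem norm_sq_le (hu : H1Pair u g) (x : ℝ) :
    ‖u x‖ ^ 2 ≤ 2 * (√(∫ x, ‖u x‖ ^ 2) * √(∫ x, ‖g x‖ ^ 2)) := by
  refine le_of_forall_pos_le_add fun ε hε => ?_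
  obtain ⟨y, -, hy⟩ := exists_ge_lt_of_integrable hu.integrable_sq hε 0
  have h_sub : ‖u x‖ ^ 2 - ‖u y‖ ^ 2 = ∫ t in y..x, 2 * inner ℝ (u t) (g t) :=
    hu.norm_sq.sub_eq y x
  have h_int := (integrable_norm_mul_norm hu.memLp hu.memLp_deriv).const_mul 2
  have h_le : ∫ t in y..x, 2 * inner ℝ (u t) (g t) ≤ ∫ t, 2 * (‖u t‖ * ‖g t‖) :=
    calc ∫ t in y..x, 2 * inner ℝ (u t) (g t)
        ≤ ∫ t in Set.uIoc y x, ‖2 * inner ℝ (u t) (g t)‖ :=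
          (Real.le_norm_self _).trans intervalIntegral.norm_integral_le_integral_norm_uIoc
      _ ≤ ∫ t in Set.uIoc y x, 2 * (‖u t‖ * ‖g t‖) := by
          refine integral_mono_of_nonneg (Eventually.of_forall fun _ => norm_nonneg _)
            h_int.integrableOn (Eventually.of_forall fun t => ?_)
          simp only [norm_mul, Real.norm_two]
          gcongr
          exact norm_inner_le_norm _ _
      _ ≤ ∫ t, 2 * (‖u t‖ * ‖g t‖) :=
          setIntegral_le_integral h_int (Eventually.of_forall fun t =>
            mul_nonneg two_pos.le (mul_nonneg (norm_nonneg _) (norm_nonneg _)))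
  rw [integral_const_mul] at h_le
  linarith [integral_norm_mul_norm_le hu.memLp hu.memLp_deriv]

theorem exists_bound (hu : H1Pair u g) : ∃ C, ∀ x, ‖u x‖ ≤ C :=
  ⟨_, fun x => Real.le_sqrt_of_sq_le (hu.norm_sq_le x)⟩

theorem integrable_rpow (hu : H1Pair u g) (hp : 2 ≤ p) : Integrable (fun x => ‖u x‖ ^ p) := by
  obtain ⟨C, hC⟩ := hu.exists_bound
  refine Integrable.mono' (hu.integrable_sq.const_mul (C ^ (p - 2))) ?_
    (Eventually.of_forall fun x => ?_)
  · exact (hu.continuous.norm.rpow_const fun x => Or.inr (by linarith)).aestronglyMeasurable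
  · rw [Real.norm_of_nonneg (by positivity)]
    exact rpow_le_rpow_sub_two_mul_sq hp (norm_nonneg _) (hC x)

theorem integral_rpow_le (hu : H1Pair u g) (hp : 2 ≤ p) (hC : ∀ x, ‖u x‖ ≤ C) :
    ∫ x, ‖u x‖ ^ p ≤ C ^ (p - 2) * ∫ x, ‖u x‖ ^ 2 := by
  rw [← integral_const_mul]
  exact integral_mono (hu.integrable_rpow hp) (hu.integrable_sq.const_mul _)
    fun x => rpow_le_rpow_sub_two_mul_sq hp (norm_nonneg _) (hC x)

theorem integral_rpow_pos (hu : H1Pair u g) (hp : 2 ≤ p) {x : ℝ} (hx : u x ≠ 0) :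
    0 < ∫ x, ‖u x‖ ^ p :=
  integral_pos_of_integrable_nonneg_nonzero
    (hu.continuous.norm.rpow_const fun x => Or.inr (by linarith)) (hu.integrable_rpow hp)
    (fun _ => by positivity) (x := x) (Real.rpow_pos_of_pos (norm_pos_iff.mpr hx) _).ne'

theorem memLp_inner (hu : H1Pair u g) : MemLp (fun x => 2 * inner ℝ (u x) (g x)) 2 := by
  obtain ⟨C, hC⟩ := hu.exists_bound
  refine MemLp.of_le_mul (c := 2 * C) hu.memLp_deriv
    ((hu.continuous.aestronglyMeasurable.inner hu.memLp_deriv.1).const_mul 2)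
    (Eventually.of_forall fun x => ?_)
  rw [norm_mul, Real.norm_two, mul_assoc]
  gcongr
  exact (norm_inner_le_norm _ _).trans (by gcongr; exact hC x)

end H1Pair

theorem exists_h1Pair_ne_zero (F : Type*) [NormedAddCommGroup F] [NormedSpace ℝ F]
    [CompleteSpace F] [Nontrivial F] : ∃ u g : ℝ → F, H1Pair u g ∧ u 0 ≠ 0 := by
  obtain ⟨e, he⟩ := exists_ne (0 : F)
  obtain ⟨ψ⟩ : Nonempty (ContDiffBump (0 : ℝ)) := inferInstance
  have hψ : ContDiff ℝ 1 ψ := ψ.contDiff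
  have hψ' : Continuous (deriv ψ) := hψ.continuous_deriv le_rfl
  refine ⟨fun x => ψ x • e, fun x => deriv ψ x • e, ⟨isPrimitive_of_hasDerivAt
    (fun x => (hψ.differentiable one_ne_zero x).hasDerivAt.smul_const e) (by fun_prop),
    (hψ.continuous.smul continuous_const).memLp_of_hasCompactSupport
      ψ.hasCompactSupport.smul_right,
    (hψ'.smul continuous_const).memLp_of_hasCompactSupport
      ψ.hasCompactSupport.deriv.smul_right⟩, ?_⟩
  simpa [ψ.one_of_mem_closedBall (Metric.mem_closedBall_self ψ.rIn_pos.le)] using he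

/-! ### Exponential extension from a half-line -/

section ExpExtend

variable {E : Type*} [NormedAddCommGroup E] [NormedSpace ℝ E] {u g : ℝ → E}

theorem norm_exp_smul_sq (c : E) (R x : ℝ) :
    ‖Real.exp (x - R) • c‖ ^ 2 = ‖c‖ ^ 2 * Real.exp (-(2 * R)) * Real.exp (2 * x) := by
  rw [norm_smul, mul_pow, Real.norm_of_nonneg (Real.exp_pos _).le, ← Real.exp_nat_mul, mul_assoc,
    ← Real.exp_add, mul_comm]
  push_cast
  ring_nf

theorem integrableOn_exp_smul_sq (c : E) (R : ℝ) :
    IntegrableOn (fun x => ‖Real.exp (x - R) • c‖ ^ 2) (Set.Iic R) := by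
  simp only [norm_exp_smul_sq]
  exact (integrableOn_exp_mul_Iic two_pos R).const_mul _

theorem integral_exp_smul_sq (c : E) (R : ℝ) :
    ∫ x in Set.Iic R, ‖Real.exp (x - R) • c‖ ^ 2 = ‖c‖ ^ 2 / 2 := by
  simp only [norm_exp_smul_sq]
  rw [integral_const_mul, integral_exp_mul_Iic two_pos, mul_div_assoc', mul_assoc, ← Real.exp_add,
    neg_add_cancel, Real.exp_zero, mul_one]

/-- The function equal to `f` on `(R, ∞)` and to `u R * exp (x - R)` on `(-∞, R]`. Applied to both
members of an `H¹` pair `(u, g)` it extends `u` from the half-line to an `H¹` function, because the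
exponential is its own derivative. -/
def expExtend (R : ℝ) (u f : ℝ → E) : ℝ → E :=
  fun x => if x ≤ R then Real.exp (x - R) • u R else f x

theorem expExtend_of_mem_Iic {R x : ℝ} (hx : x ∈ Set.Iic R) (f : ℝ → E) :
    expExtend R u f x = Real.exp (x - R) • u R :=
  if_pos hx

theorem expExtend_of_mem_Ioi {R x : ℝ} (hx : x ∈ Set.Ioi R) (f : ℝ → E) :
    expExtend R u f x = f x :=
  if_neg (not_le.mpr hx)

theorem memLp_expExtend {f : ℝ → E} {R : ℝ} (hf : MemLp f 2 (volume.restrict (Set.Ioi R))) :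
    MemLp (expExtend R u f) 2 := by
  classical
  have h_exp : MemLp (fun x : ℝ => Real.exp (x - R) • u R) 2 (volume.restrict (Set.Iic R)) := by
    rw [memLp_two_iff_integrable_sq_norm (by fun_prop)]
    exact integrableOn_exp_smul_sq _ _
  exact MemLp.piecewise (s := Set.Iic R) measurableSet_Iic h_exp (by rwa [Set.compl_Iic])

theorem h1Pair_expExtend [CompleteSpace E] (hu : H1Pair u g) (R : ℝ) :
    H1Pair (expExtend R u u) (expExtend R u g) := by
  have h_exp : IsPrimitive (fun x : ℝ => Real.exp (x - R) • u R)
      (fun x : ℝ => Real.exp (x - R) • u R) := by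
    refine isPrimitive_of_hasDerivAt (fun x => ?_) (by fun_prop)
    have h_deriv : HasDerivAt (fun x : ℝ => Real.exp (x - R)) (Real.exp (x - R)) x := by
      simpa using ((hasDerivAt_id x).sub_const R).exp
    exact h_deriv.smul_const _
  exact ⟨h_exp.glue hu.toIsPrimitive (by rw [sub_self, Real.exp_zero, one_smul]),
    memLp_expExtend (hu.memLp.restrict _), memLp_expExtend (hu.memLp_deriv.restrict _)⟩

theorem integral_norm_expExtend_sq [CompleteSpace E] (hu : H1Pair u g) (R : ℝ) :
    ∫ x, ‖expExtend R u u x‖ ^ 2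
      = (∫ x in Set.Ioi R, ‖u x‖ ^ 2) + ‖u R‖ ^ 2 / 2 := by
  have h_int := (h1Pair_expExtend hu R).integrable_sq
  rw [← intervalIntegral.integral_Iic_add_Ioi (b := R) h_int.integrableOn h_int.integrableOn,
    add_comm, ← integral_exp_smul_sq (u R) R]
  congr 1
  · exact setIntegral_congr_fun measurableSet_Ioi fun x hx => by
      simp only [expExtend_of_mem_Ioi hx]
  · exact setIntegral_congr_fun measurableSet_Iic fun x hx => by
      simp only [expExtend_of_mem_Iic hx]

end ExpExtend

/-! ### The energy in terms of the continuous representative -/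

section Energy

variable {F : Type*} [NormedAddCommGroup F] [InnerProductSpace ℝ F] {u g : ℝ → F}
  {k θ p ν : ℝ}

/-- The density `½|u'|² + (k/4)|(|u|²)'|²` of the derivative terms of the energy, at a point where
`u` has value `a` and slope `b`; there `(|u|²)' = 2⟪a, b⟫`. -/
def kineticDensity (k : ℝ) (a b : F) : ℝ :=
  1 / 2 * ‖b‖ ^ 2 + k / 4 * (2 * inner ℝ a b) ^ 2

/-- The part of the energy of the pair `(u, g)` that involves derivatives. -/
def kineticEnergy (k : ℝ) (u g : ℝ → F) : ℝ :=
  ∫ x, kineticDensity k (u x) (g x)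

/-- The energy `I` of the pair `(u, g)`, with `g` in the role of `u'`. -/
def pairEnergy (k θ p : ℝ) (u g : ℝ → F) : ℝ :=
  kineticEnergy k u g - θ / p * ∫ x, ‖u x‖ ^ p

/-- The density of the action `I(u) - ν ∫ |u|²`, at a point where `u` has value `a` and
slope `b`. -/
def actionDensity (k θ p ν : ℝ) (a b : F) : ℝ :=
  kineticDensity k a b - θ / p * ‖a‖ ^ p - ν * ‖a‖ ^ 2

theorem half_norm_sq_le_kineticDensity (hk : 0 ≤ k) (a b : F) :
    1 / 2 * ‖b‖ ^ 2 ≤ kineticDensity k a b :=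
  le_add_of_nonneg_right (by positivity)

theorem kineticDensity_nonneg (hk : 0 ≤ k) (a b : F) : 0 ≤ kineticDensity k a b := by
  unfold kineticDensity
  positivity

theorem kineticEnergy_nonneg (hk : 0 ≤ k) (u g : ℝ → F) : 0 ≤ kineticEnergy k u g :=
  integral_nonneg fun _ => kineticDensity_nonneg hk _ _

theorem kineticDensity_neg_right (k : ℝ) (a b : F) :
    kineticDensity k a (-b) = kineticDensity k a b := by
  simp only [kineticDensity, inner_neg_right, norm_neg, mul_neg, neg_sq]

theorem actionDensity_neg_right (k θ p ν : ℝ) (a b : F) :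
    actionDensity k θ p ν a (-b) = actionDensity k θ p ν a b := by
  simp only [actionDensity, kineticDensity_neg_right]

theorem actionDensity_self_le {a : F} {B : ℝ} (hk : 0 ≤ k) (hθ : 0 ≤ θ) (hp : 0 ≤ p)
    (ha : ‖a‖ ≤ B) : actionDensity k θ p ν a a ≤ (1 / 2 + k * B ^ 2 - ν) * ‖a‖ ^ 2 := by
  have h_pot : 0 ≤ θ / p * ‖a‖ ^ p := by positivity
  have h_quartic : k * ‖a‖ ^ 2 * ‖a‖ ^ 2 ≤ k * B ^ 2 * ‖a‖ ^ 2 := by gcongr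
  rw [actionDensity, kineticDensity, real_inner_self_eq_norm_sq]
  linarith

theorem kineticDensity_smul (k c s : ℝ) (a b : F) :
    kineticDensity k (c • a) ((c * s) • b) = c ^ 2 * s ^ 2 * kineticDensity (c ^ 2 * k) a b := by
  simp only [kineticDensity, norm_smul, mul_pow, Real.norm_eq_abs, sq_abs, real_inner_smul_left,
    real_inner_smul_right]
  ring

theorem kineticEnergy_comp (k c : ℝ) {a : ℝ} (ha : a ≠ 0) (b : ℝ) (u g : ℝ → F) :
    kineticEnergy k (fun x => c • u (a * x + b)) (fun x => (c * a) • g (a * x + b))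
      = c ^ 2 * |a| * kineticEnergy (c ^ 2 * k) u g := by
  simp only [kineticEnergy, kineticDensity_smul]
  rw [integral_const_mul, integral_comp_mul_add (fun x => kineticDensity (c ^ 2 * k) (u x) (g x)),
    smul_eq_mul, ← sq_abs a, ← mul_assoc]
  field_simp

theorem pairEnergy_comp (k θ p c : ℝ) {a : ℝ} (ha : a ≠ 0) (b : ℝ) (u g : ℝ → F) :
    pairEnergy k θ p (fun x => c • u (a * x + b)) (fun x => (c * a) • g (a * x + b))
      = c ^ 2 * |a| * kineticEnergy (c ^ 2 * k) u g
        - θ / p * (|c| ^ p * |a|⁻¹ * ∫ x, ‖u x‖ ^ p) := by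
  rw [pairEnergy, kineticEnergy_comp k c ha, integral_norm_rpow_comp]

variable [CompleteSpace F]

namespace H1Pair

theorem integrable_kineticDensity (hu : H1Pair u g) (k : ℝ) :
    Integrable (fun x => kineticDensity k (u x) (g x)) :=
  (hu.integrable_deriv_sq.const_mul _).add (hu.memLp_inner.integrable_sq.const_mul _)

theorem half_integral_deriv_sq_le (hk : 0 ≤ k) (hu : H1Pair u g) :
    1 / 2 * ∫ x, ‖g x‖ ^ 2 ≤ kineticEnergy k u g := by
  rw [← integral_const_mul]
  exact integral_mono (hu.integrable_deriv_sq.const_mul _) (hu.integrable_kineticDensity k)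
    fun x => half_norm_sq_le_kineticDensity hk _ _

theorem kineticEnergy_pos (hk : 0 ≤ k) (hu : H1Pair u g) {x : ℝ} (hx : u x ≠ 0) :
    0 < kineticEnergy k u g := by
  refine lt_of_lt_of_le ?_ (hu.half_integral_deriv_sq_le hk)
  by_contra! h_nonpos
  have h_deriv : ∫ x, ‖g x‖ ^ 2 ≤ 0 := by linarith
  have h_sq := hu.norm_sq_le x
  rw [Real.sqrt_eq_zero_of_nonpos h_deriv, mul_zero, mul_zero] at h_sq
  exact hx (by simpa using h_sq)

theorem kineticEnergy_mono {k' : ℝ} (hu : H1Pair u g) (hk : k ≤ k') :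
    kineticEnergy k u g ≤ kineticEnergy k' u g := by
  refine integral_mono (hu.integrable_kineticDensity k) (hu.integrable_kineticDensity k')
    fun x => ?_
  simp only [kineticDensity]
  gcongr

theorem integrable_actionDensity (hu : H1Pair u g) (hp : 2 ≤ p) :
    Integrable (fun x => actionDensity k θ p ν (u x) (g x)) :=
  ((hu.integrable_kineticDensity k).sub ((hu.integrable_rpow hp).const_mul _)).sub
    (hu.integrable_sq.const_mul ν)

theorem integral_actionDensity (hu : H1Pair u g) (hp : 2 ≤ p) :
    ∫ x, actionDensity k θ p ν (u x) (g x) = pairEnergy k θ p u g - ν * ∫ x, ‖u x‖ ^ 2 := by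
  have h_pot := (hu.integrable_rpow hp).const_mul (θ / p)
  have h_energy : Integrable (fun x => kineticDensity k (u x) (g x) - θ / p * ‖u x‖ ^ p) :=
    (hu.integrable_kineticDensity k).sub h_pot
  simp only [actionDensity]
  rw [integral_sub h_energy (hu.integrable_sq.const_mul ν),
    integral_sub (hu.integrable_kineticDensity k) h_pot, integral_const_mul, integral_const_mul,
    pairEnergy, kineticEnergy]

end H1Pair

end Energy

section Complex

variable {u g v : ℝ → ℂ} {k θ p lam : ℝ}

namespace H1Pair

theorem isWeakDeriv_of_ae_eq (hu : H1Pair u g) (huv : v =ᵐ[volume] u) : IsWeakDeriv v g :=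
  hu.isWeakDeriv.congr huv.symm

theorem energy_eq (hu : H1Pair u g) (huv : v =ᵐ[volume] u) (hp : 2 ≤ p) :
    energy k θ p v = pairEnergy k θ p u g := by
  have h_deriv := (hu.isWeakDeriv_of_ae_eq huv).weakDeriv_ae_eq
  have h_deriv_sq : weakDeriv (fun y => ‖v y‖ ^ 2) =ᵐ[volume] fun x => 2 * inner ℝ (u x) (g x) :=
    (hu.norm_sq.isWeakDeriv.congr (huv.symm.mono fun x hx => by simp only [hx])).weakDeriv_ae_eq
  rw [pairEnergy, kineticEnergy, ← integral_const_mul,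
    ← integral_sub (hu.integrable_kineticDensity k) ((hu.integrable_rpow hp).const_mul _)]
  refine integral_congr_ae ?_
  filter_upwards [huv, h_deriv, h_deriv_sq] with x hx hx' hx_sq
  simp only [kineticDensity, hx, hx', hx_sq, sq_abs]

theorem mem_massSphere (hu : H1Pair u g) (huv : v =ᵐ[volume] u)
    (hm : ∫ x, ‖u x‖ ^ 2 = 2 * lam) : v ∈ massSphere lam :=
  ⟨⟨hu.memLp.ae_eq huv.symm, g, hu.memLp_deriv, hu.isWeakDeriv_of_ae_eq huv⟩,
    by rw [integral_norm_sq_congr huv, hm]; ring⟩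

theorem h1Norm_eq (hu : H1Pair u g) (huv : v =ᵐ[volume] u) :
    h1Norm v = √((∫ x, ‖g x‖ ^ 2) + ∫ x, ‖u x‖ ^ 2) := by
  rw [h1Norm, ← integral_add hu.integrable_deriv_sq hu.integrable_sq]
  congr 1
  refine integral_congr_ae ?_
  filter_upwards [huv, (hu.isWeakDeriv_of_ae_eq huv).weakDeriv_ae_eq] with x hx hx'
  simp only [hx, hx']

end H1Pair

theorem exists_h1Pair_of_mem_massSphere (hv : v ∈ massSphere lam) :
    ∃ u g, H1Pair u g ∧ v =ᵐ[volume] u ∧ ∫ x, ‖u x‖ ^ 2 = 2 * lam := by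
  obtain ⟨⟨hv_memLp, g, hg, hvg⟩, hm⟩ := hv
  obtain ⟨u, hu, huv⟩ := hvg.exists_isPrimitive
  refine ⟨u, g, ⟨hu, hv_memLp.ae_eq huv, hg⟩, huv, ?_⟩
  rw [← integral_norm_sq_congr huv]
  linarith

end Complex

end Pairs

section Bounds

/-! ### Coercivity and boundedness from below -/

theorem exists_mul_rpow_le_mul_add {C ε s : ℝ} (hC : 0 ≤ C) (hε : 0 < ε) (hs0 : 0 ≤ s)
    (hs1 : s < 1) : ∃ C', ∀ x : ℝ, 0 ≤ x → C * x ^ s ≤ ε * x + C' := by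
  set T := (C / ε) ^ (1 / (1 - s)) with hT
  have hT0 : 0 ≤ T := by positivity
  have hCT : 0 ≤ C * T ^ s := by positivity
  refine ⟨C * T ^ s, fun x hx => ?_⟩
  rcases le_total x T with hxT | hTx
  · have h_le : C * x ^ s ≤ C * T ^ s := by gcongr
    linarith [mul_nonneg hε.le hx]
  · have h_large : C / ε ≤ x ^ (1 - s) :=
      calc C / ε = T ^ (1 - s) := by
            rw [hT, ← Real.rpow_mul (by positivity), one_div_mul_cancel (by linarith),
              Real.rpow_one]
        _ ≤ x ^ (1 - s) := Real.rpow_le_rpow hT0 hTx (by linarith)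
    have h_le : C * x ^ s ≤ ε * x :=
      calc C * x ^ s ≤ ε * x ^ (1 - s) * x ^ s := by
            gcongr
            exact (div_le_iff₀' hε).mp h_large
        _ = ε * x := by
            rw [mul_assoc, ← Real.rpow_add_of_nonneg hx (by linarith) hs0, sub_add_cancel,
              Real.rpow_one]
    linarith

variable {F : Type*} [NormedAddCommGroup F] [InnerProductSpace ℝ F] [CompleteSpace F]
  {u g : ℝ → F} {k θ p M ν : ℝ}

/-- A Gagliardo–Nirenberg inequality. -/
theorem H1Pair.integral_rpow_le_mass_mul_rpow (hu : H1Pair u g) (hp : 2 ≤ p) :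
    ∫ x, ‖u x‖ ^ p ≤ (2 * √(∫ x, ‖u x‖ ^ 2)) ^ ((p - 2) / 2) * (∫ x, ‖u x‖ ^ 2)
      * (∫ x, ‖g x‖ ^ 2) ^ ((p - 2) / 4) := by
  have hD : 0 ≤ ∫ x, ‖g x‖ ^ 2 := integral_nonneg fun _ => by positivity
  refine (hu.integral_rpow_le hp fun x => Real.le_sqrt_of_sq_le (hu.norm_sq_le x)).trans_eq ?_
  rw [← mul_assoc, Real.sqrt_eq_rpow (2 * _ * _), ← Real.rpow_mul (by positivity),
    Real.mul_rpow (by positivity) (by positivity), Real.sqrt_eq_rpow (∫ x, ‖g x‖ ^ 2),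
    ← Real.rpow_mul hD]
  ring_nf

theorem exists_integral_deriv_sq_le_pairEnergy_add (F : Type*) [NormedAddCommGroup F]
    [InnerProductSpace ℝ F] [CompleteSpace F] (hk : 0 ≤ k) (hθ : 0 ≤ θ) (hM : 0 ≤ M)
    (hp2 : 2 ≤ p) (hp6 : p < 6) :
    ∃ C, ∀ u g : ℝ → F, H1Pair u g → ∫ x, ‖u x‖ ^ 2 = M →
      1 / 4 * (∫ x, ‖g x‖ ^ 2) ≤ pairEnergy k θ p u g + C := by
  obtain ⟨C, hC⟩ := exists_mul_rpow_le_mul_add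
    (C := θ / p * ((2 * √M) ^ ((p - 2) / 2) * M)) (ε := 1 / 4) (s := (p - 2) / 4)
    (by positivity) (by norm_num) (by linarith) (by linarith)
  refine ⟨C, fun u g hu hm => ?_⟩
  have h_pot : θ / p * ∫ x, ‖u x‖ ^ p ≤ 1 / 4 * (∫ x, ‖g x‖ ^ 2) + C := by
    refine le_trans ?_ (hC _ (integral_nonneg fun x => by positivity))
    rw [mul_assoc, ← hm]
    gcongr
    exact hu.integral_rpow_le_mass_mul_rpow hp2
  have h_kin := hu.half_integral_deriv_sq_le hk
  rw [pairEnergy]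
  linarith

/-! ### Negativity of the infimum -/

theorem exists_mul_rpow_lt {A B r : ℝ} (hB : 0 < B) (hr : 0 < r) :
    ∃ s, 0 < s ∧ s ≤ 1 ∧ A * s ^ r < B := by
  have h_lim : Tendsto (fun s : ℝ => A * s ^ r) (𝓝 0) (𝓝 0) := by
    simpa [Real.zero_rpow hr.ne'] using
      (Real.continuousAt_rpow_const 0 r (Or.inr hr.le)).tendsto.const_mul A
  have h_event : ∀ᶠ s in 𝓝[>] (0 : ℝ), A * s ^ r < B ∧ s ≤ 1 :=
    ((h_lim.eventually_lt_const hB).and (eventually_le_nhds one_pos)).filter_mono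
      nhdsWithin_le_nhds
  obtain ⟨s, ⟨hs, hs1⟩, hs0⟩ := (h_event.and self_mem_nhdsWithin).exists
  exact ⟨s, hs0, hs1, hs⟩

/-- Spreading `u` to `√(κ s) u(s ·)` keeps the mass, while for small `s` the potential term, of
order `s ^ (p / 2 - 1)`, dominates the derivative terms, which are `O(s ^ 2)`. -/
theorem exists_pairEnergy_neg (F : Type*) [NormedAddCommGroup F] [InnerProductSpace ℝ F]
    [CompleteSpace F] [Nontrivial F] (hk : 0 ≤ k) (hθ : 0 < θ) (hM : 0 < M) (hp2 : 2 ≤ p)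
    (hp6 : p < 6) :
    ∃ u g : ℝ → F, H1Pair u g ∧ ∫ x, ‖u x‖ ^ 2 = M ∧ pairEnergy k θ p u g < 0 := by
  obtain ⟨u, g, hu, hu0⟩ := exists_h1Pair_ne_zero F
  have hm : 0 < ∫ x, ‖u x‖ ^ 2 := hu.integral_sq_pos hu0
  have hP : 0 < ∫ x, ‖u x‖ ^ p := hu.integral_rpow_pos hp2 hu0
  set κ := M / ∫ x, ‖u x‖ ^ 2 with hκ
  have hκ0 : 0 < κ := by positivity
  obtain ⟨s, hs0, hs1, hs⟩ := exists_mul_rpow_lt (A := κ * kineticEnergy (κ * k) u g)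
    (B := θ / p * (κ ^ (p / 2) * ∫ x, ‖u x‖ ^ p)) (r := 3 - p / 2) (by positivity) (by linarith)
  have h_sq : √(κ * s) ^ 2 = κ * s := Real.sq_sqrt (by positivity)
  refine ⟨_, _, hu.comp_mul_add (√(κ * s)) hs0.ne' 0, ?_, ?_⟩
  · rw [integral_norm_sq_comp, h_sq, abs_of_pos hs0, hκ]
    field_simp
  have h_kin : kineticEnergy (κ * s * k) u g ≤ kineticEnergy (κ * k) u g :=
    hu.kineticEnergy_mono (by gcongr; exact mul_le_of_le_one_right hκ0.le hs1)
  have h_split : s ^ 2 = s ^ (p / 2 - 1) * s ^ (3 - p / 2) := by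
    rw [← Real.rpow_add hs0, ← Real.rpow_natCast]
    norm_num
  have h_pow : √(κ * s) ^ p * s⁻¹ = κ ^ (p / 2) * s ^ (p / 2 - 1) := by
    rw [Real.sqrt_eq_rpow, ← Real.rpow_mul (by positivity), one_div_mul_eq_div,
      Real.mul_rpow hκ0.le hs0.le, Real.rpow_sub_one hs0.ne', mul_assoc, ← div_eq_mul_inv]
  rw [pairEnergy_comp k θ p _ hs0.ne', abs_of_pos hs0, abs_of_nonneg (Real.sqrt_nonneg _), h_sq,
    h_pow, sub_neg]
  calc κ * s * s * kineticEnergy (κ * s * k) u g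
      ≤ κ * s * s * kineticEnergy (κ * k) u g := by gcongr
    _ = s ^ (p / 2 - 1) * (κ * kineticEnergy (κ * k) u g * s ^ (3 - p / 2)) := by
        linear_combination (κ * kineticEnergy (κ * k) u g) * h_split
    _ < s ^ (p / 2 - 1) * (θ / p * (κ ^ (p / 2) * ∫ x, ‖u x‖ ^ p)) := by gcongr
    _ = θ / p * (κ ^ (p / 2) * s ^ (p / 2 - 1) * ∫ x, ‖u x‖ ^ p) := by ring

/-! ### Scaling and the sign of the action -/

/-- `ν * M` is a lower bound for the energy of the `F`-valued `H¹` pairs of mass `M`. The best such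
`ν` is the energy per unit mass of a minimizer. -/
def IsEnergyPerMassBound (F : Type*) [NormedAddCommGroup F] [InnerProductSpace ℝ F]
    (k θ p M ν : ℝ) : Prop :=
  ∀ u g : ℝ → F, H1Pair u g → ∫ x, ‖u x‖ ^ 2 = M → ν * M ≤ pairEnergy k θ p u g

namespace IsEnergyPerMassBound

/-- Compares `u` with the dilate `u (s ·)` of mass `M`. -/
theorem mul_kineticEnergy_le_action (hν : IsEnergyPerMassBound F k θ p M ν) (hM : 0 < M)
    (hp : 2 < p) (hu : H1Pair u g) :
    (1 - ((∫ x, ‖u x‖ ^ 2) / M) ^ 2) * kineticEnergy k u g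
      ≤ ∫ x, actionDensity k θ p ν (u x) (g x) := by
  rw [hu.integral_actionDensity hp.le, pairEnergy]
  have hm : 0 ≤ ∫ x, ‖u x‖ ^ 2 := integral_nonneg fun _ => by positivity
  set m := ∫ x, ‖u x‖ ^ 2
  rcases hm.eq_or_lt with hm0 | hm0
  · obtain ⟨C, hC⟩ := hu.exists_bound
    have h_pot : ∫ x, ‖u x‖ ^ p = 0 :=
      le_antisymm ((hu.integral_rpow_le hp.le hC).trans_eq (mul_eq_zero_of_right _ hm0.symm))
        (integral_nonneg fun _ => by positivity)
    simp [h_pot, ← hm0]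
  have hs : 0 < m / M := by positivity
  have h_bound := hν _ _ (hu.comp_mul_add 1 hs.ne' 0) (by
    rw [integral_norm_sq_comp, abs_of_pos hs]
    change 1 ^ 2 * (m / M)⁻¹ * m = M
    field_simp)
  rw [pairEnergy_comp k θ p 1 hs.ne', abs_of_pos hs, abs_one, Real.one_rpow, one_pow, one_mul,
    one_mul, one_mul] at h_bound
  have h_scaled : m / M * (ν * M)
      ≤ m / M * (m / M * kineticEnergy k u g - θ / p * ((m / M)⁻¹ * ∫ x, ‖u x‖ ^ p)) := by
    gcongr
  have h_left : m / M * (ν * M) = ν * m := by field_simp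
  have h_cancel : m / M * (m / M)⁻¹ = 1 := mul_inv_cancel₀ hs.ne'
  linear_combination h_scaled - h_left - (θ / p * ∫ x, ‖u x‖ ^ p) * h_cancel

theorem action_nonneg (hν : IsEnergyPerMassBound F k θ p M ν) (hk : 0 ≤ k) (hM : 0 < M)
    (hp : 2 < p) (hu : H1Pair u g) (hm : ∫ x, ‖u x‖ ^ 2 ≤ M) :
    0 ≤ ∫ x, actionDensity k θ p ν (u x) (g x) := by
  have hm0 : 0 ≤ ∫ x, ‖u x‖ ^ 2 := integral_nonneg fun _ => by positivity
  refine (mul_nonneg (sub_nonneg.mpr ?_) (kineticEnergy_nonneg hk u g)).trans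
    (hν.mul_kineticEnergy_le_action hM hp hu)
  exact pow_le_one₀ (div_nonneg hm0 hM.le) ((div_le_one hM).mpr hm)

theorem le_mass_of_action_nonpos (hν : IsEnergyPerMassBound F k θ p M ν) (hM : 0 < M)
    (hp : 2 < p) (hu : H1Pair u g) (h_kin : 0 < kineticEnergy k u g)
    (h_action : ∫ x, actionDensity k θ p ν (u x) (g x) ≤ 0) : M ≤ ∫ x, ‖u x‖ ^ 2 := by
  have hm0 : 0 ≤ ∫ x, ‖u x‖ ^ 2 := integral_nonneg fun _ => by positivity
  by_contra! hlt
  have h_lt_one : ((∫ x, ‖u x‖ ^ 2) / M) ^ 2 < 1 :=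
    pow_lt_one₀ (div_nonneg hm0 hM.le) ((div_lt_one hM).mpr hlt) two_ne_zero
  have h_pos := mul_pos (sub_pos.mpr h_lt_one) h_kin
  linarith [hν.mul_kineticEnergy_le_action hM hp hu]

end IsEnergyPerMassBound

/-! ### The action on a half-line -/

namespace IsEnergyPerMassBound

/-- Replace `u` on `(-∞, R]` by an exponential tail, whose action is controlled by `‖u R‖ ^ 2`, and
use that the total action is nonnegative. -/
theorem le_action_Ioi (hν : IsEnergyPerMassBound F k θ p M ν) (hk : 0 ≤ k) (hθ : 0 ≤ θ)
    (hM : 0 < M) (hp : 2 < p) (hu : H1Pair u g) {B R : ℝ} (hB : ‖u R‖ ≤ B)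
    (hm : (∫ x in Set.Ioi R, ‖u x‖ ^ 2) + ‖u R‖ ^ 2 / 2 ≤ M) :
    -((1 / 2 + k * B ^ 2 - ν) * (‖u R‖ ^ 2 / 2))
      ≤ ∫ x in Set.Ioi R, actionDensity k θ p ν (u x) (g x) := by
  have hw := h1Pair_expExtend hu R
  have h_total := hν.action_nonneg hk hM hp hw (by rwa [integral_norm_expExtend_sq hu])
  have h_int := hw.integrable_actionDensity (k := k) (θ := θ) (ν := ν) hp.le
  have h_tail : ∫ x in Set.Iic R, actionDensity k θ p ν (expExtend R u u x) (expExtend R u g x)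
      ≤ (1 / 2 + k * B ^ 2 - ν) * (‖u R‖ ^ 2 / 2) := by
    rw [← integral_exp_smul_sq, ← integral_const_mul]
    refine setIntegral_mono_on h_int.integrableOn
      ((integrableOn_exp_smul_sq _ _).const_mul _) measurableSet_Iic fun x hx => ?_
    rw [expExtend_of_mem_Iic hx, expExtend_of_mem_Iic hx]
    refine actionDensity_self_le hk hθ (by linarith) (le_trans ?_ hB)
    rw [norm_smul, Real.norm_of_nonneg (Real.exp_pos _).le]
    exact mul_le_of_le_one_left (norm_nonneg _) (Real.exp_le_one_iff.mpr (sub_nonpos.mpr hx))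
  rw [← intervalIntegral.integral_Iic_add_Ioi h_int.integrableOn h_int.integrableOn,
    setIntegral_congr_fun (s := Set.Ioi R) (g := fun x => actionDensity k θ p ν (u x) (g x))
      measurableSet_Ioi fun x hx => by
        simp only [expExtend_of_mem_Ioi hx]] at h_total
  linarith

theorem le_action_Iic (hν : IsEnergyPerMassBound F k θ p M ν) (hk : 0 ≤ k) (hθ : 0 ≤ θ)
    (hM : 0 < M) (hp : 2 < p) (hu : H1Pair u g) {B R : ℝ} (hB : ‖u R‖ ≤ B)
    (hm : (∫ x in Set.Iic R, ‖u x‖ ^ 2) + ‖u R‖ ^ 2 / 2 ≤ M) :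
    -((1 / 2 + k * B ^ 2 - ν) * (‖u R‖ ^ 2 / 2))
      ≤ ∫ x in Set.Iic R, actionDensity k θ p ν (u x) (g x) := by
  have h_reflect := hν.le_action_Ioi hk hθ hM hp hu.reflect (B := B) (R := -R) (by simpa using hB)
    (by simpa [integral_comp_neg_Ioi (-R) (fun x => ‖u x‖ ^ 2)] using hm)
  simp only [actionDensity_neg_right, neg_neg] at h_reflect
  rwa [integral_comp_neg_Ioi (-R) (fun x => actionDensity k θ p ν (u x) (g x)), neg_neg]
    at h_reflect

end IsEnergyPerMassBound

end Bounds

section Limits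

/-! ### Convergence of integrals -/

section MeasureSpace

variable {α E : Type*} [MeasurableSpace α] {μ : Measure α} [NormedAddCommGroup E]

theorem integrable_and_integral_norm_le_of_tendsto {f : ℕ → α → E} {F : α → E} {C : ℝ}
    (hf : ∀ n, Integrable (f n) μ) (h_lim : ∀ᵐ x ∂μ, Tendsto (fun n => f n x) atTop (𝓝 (F x)))
    (hC : ∀ n, ∫ x, ‖f n x‖ ∂μ ≤ C) : Integrable F μ ∧ ∫ x, ‖F x‖ ∂μ ≤ C := by
  have hC0 : 0 ≤ C := (integral_nonneg fun _ => norm_nonneg _).trans (hC 0)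
  have h_fatou : ∫⁻ x, ‖F x‖ₑ ∂μ ≤ ENNReal.ofReal C :=
    calc ∫⁻ x, ‖F x‖ₑ ∂μ = ∫⁻ x, liminf (fun n => ‖f n x‖ₑ) atTop ∂μ :=
          lintegral_congr_ae (h_lim.mono fun x hx => hx.enorm.liminf_eq.symm)
      _ ≤ liminf (fun n => ∫⁻ x, ‖f n x‖ₑ ∂μ) atTop :=
          lintegral_liminf_le' fun n => (hf n).1.enorm
      _ ≤ ENNReal.ofReal C := by
          refine liminf_le_of_frequently_le' (Frequently.of_forall fun n => ?_)
          rw [← ofReal_integral_norm_eq_lintegral_enorm (hf n)]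
          exact ENNReal.ofReal_le_ofReal (hC n)
  have h_int : Integrable F μ :=
    ⟨aestronglyMeasurable_of_tendsto_ae atTop (fun n => (hf n).1) h_lim,
      h_fatou.trans_lt ENNReal.ofReal_lt_top⟩
  refine ⟨h_int, (ENNReal.ofReal_le_ofReal_iff hC0).mp ?_⟩
  rwa [ofReal_integral_norm_eq_lintegral_enorm h_int]

/-- Scheffé's lemma: `(H - G n)⁺` is dominated by `H`, and
`|G n - H| = (G n - H) + 2 (H - G n)⁺`. -/
theorem tendsto_integral_abs_sub_of_tendsto {G : ℕ → α → ℝ} {H : α → ℝ}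
    (hG : ∀ n, Integrable (G n) μ) (hH : Integrable H μ) (hG0 : ∀ n, ∀ᵐ x ∂μ, 0 ≤ G n x)
    (h_lim : ∀ᵐ x ∂μ, Tendsto (fun n => G n x) atTop (𝓝 (H x)))
    (h_int : Tendsto (fun n => ∫ x, G n x ∂μ) atTop (𝓝 (∫ x, H x ∂μ))) :
    Tendsto (fun n => ∫ x, |G n x - H x| ∂μ) atTop (𝓝 0) := by
  have hH0 : ∀ᵐ x ∂μ, 0 ≤ H x := by
    filter_upwards [h_lim, ae_all_iff.mpr hG0] with x hx hx0
    exact ge_of_tendsto' hx hx0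
  have h_pos_int : ∀ n, Integrable (fun x => max (H x - G n x) 0) μ := fun n =>
    (hH.sub (hG n)).pos_part
  have h_pos : Tendsto (fun n => ∫ x, max (H x - G n x) 0 ∂μ) atTop (𝓝 0) := by
    have h_dom := tendsto_integral_of_dominated_convergence (f := fun _ => (0 : ℝ)) H
      (fun n => (h_pos_int n).1) hH
      (fun n => by
        filter_upwards [hG0 n, hH0] with x hGx hHx
        rw [Real.norm_of_nonneg (le_max_right _ _)]
        exact max_le (sub_le_self _ hGx) hHx)
      (h_lim.mono fun x hx => by
        simpa using (hx.const_sub (H x)).max (tendsto_const_nhds (x := (0 : ℝ))))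
    simpa using h_dom
  have h_split : ∀ n, ∫ x, |G n x - H x| ∂μ
      = (∫ x, G n x ∂μ) - (∫ x, H x ∂μ) + 2 * ∫ x, max (H x - G n x) 0 ∂μ := fun n => by
    have h_diff_int : Integrable (fun x => G n x - H x) μ := (hG n).sub hH
    rw [← integral_sub (hG n) hH, ← integral_const_mul,
      ← integral_add h_diff_int ((h_pos_int n).const_mul 2)]
    refine integral_congr_ae (Eventually.of_forall fun x => ?_)
    grind
  simp only [h_split]
  simpa using (h_int.sub_const (∫ x, H x ∂μ)).add (h_pos.const_mul 2)

theorem tendsto_integral_of_tendsto_bounds [NormedSpace ℝ E] {f : ℕ → α → E} {F : α → E}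
    {G : ℕ → α → ℝ} {H : α → ℝ} (hf : ∀ n, AEStronglyMeasurable (f n) μ)
    (hG : ∀ n, Integrable (G n) μ) (hH : Integrable H μ) (h_le : ∀ n, ∀ᵐ x ∂μ, ‖f n x‖ ≤ G n x)
    (hf_lim : ∀ᵐ x ∂μ, Tendsto (fun n => f n x) atTop (𝓝 (F x)))
    (hG_lim : ∀ᵐ x ∂μ, Tendsto (fun n => G n x) atTop (𝓝 (H x)))
    (h_int : Tendsto (fun n => ∫ x, G n x ∂μ) atTop (𝓝 (∫ x, H x ∂μ))) :
    Tendsto (fun n => ∫ x, f n x ∂μ) atTop (𝓝 (∫ x, F x ∂μ)) := by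
  have hF_le : ∀ᵐ x ∂μ, ‖F x‖ ≤ H x := by
    filter_upwards [hf_lim, hG_lim, ae_all_iff.mpr h_le] with x hfx hGx hx
    exact le_of_tendsto_of_tendsto' hfx.norm hGx hx
  have hf_int : ∀ n, Integrable (f n) μ := fun n => (hG n).mono' (hf n) (h_le n)
  have hF_int : Integrable F μ :=
    hH.mono' (aestronglyMeasurable_of_tendsto_ae atTop hf hf_lim) hF_le
  have h_scheffe := tendsto_integral_abs_sub_of_tendsto hG hH
    (fun n => (h_le n).mono fun x hx => (norm_nonneg _).trans hx) hG_lim h_int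
  have h_min_int : ∀ n, Integrable (fun x => min ‖f n x - F x‖ (2 * H x)) μ := fun n =>
    ((hf_int n).sub hF_int).norm.inf (hH.const_mul 2)
  have h_min : Tendsto (fun n => ∫ x, min ‖f n x - F x‖ (2 * H x) ∂μ) atTop (𝓝 0) := by
    have h_dom := tendsto_integral_of_dominated_convergence (f := fun _ => (0 : ℝ))
      (fun x => 2 * H x) (fun n => (h_min_int n).1) (hH.const_mul 2)
      (fun n => by
        filter_upwards [hF_le] with x hx
        have hHx : 0 ≤ H x := (norm_nonneg _).trans hx
        rw [Real.norm_of_nonneg (by positivity)]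
        exact min_le_right _ _)
      (by
        filter_upwards [hf_lim, hF_le] with x hx hFx
        have hHx : 0 ≤ 2 * H x := by linarith [norm_nonneg (F x)]
        simpa [hHx] using (hx.sub_const (F x)).norm.min (tendsto_const_nhds (x := 2 * H x)))
    simpa using h_dom
  rw [tendsto_iff_norm_sub_tendsto_zero]
  refine squeeze_zero (fun _ => norm_nonneg _) (fun n => ?_)
    (by simpa only [add_zero] using h_min.add h_scheffe)
  have h_abs_int : Integrable (fun x => |G n x - H x|) μ := ((hG n).sub hH).abs
  rw [← integral_sub (hf_int n) hF_int, ← integral_add (h_min_int n) h_abs_int]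
  refine (norm_integral_le_integral_norm _).trans (integral_mono_ae ((hf_int n).sub hF_int).norm
    ((h_min_int n).add h_abs_int) ?_)
  filter_upwards [hF_le, h_le n] with x hFx hfx
  have h_tri := norm_sub_le (f n x) (F x)
  have h_abs := le_abs_self (G n x - H x)
  grind

end MeasureSpace

/-! ### Weak convergence in `L²` -/

section Weak

theorem exists_subseq_tendsto_inner {H : Type*} [NormedAddCommGroup H] [InnerProductSpace ℝ H]
    [CompleteSpace H] [TopologicalSpace.SeparableSpace H] {x : ℕ → H} {C : ℝ}
    (hx : ∀ n, ‖x n‖ ≤ C) :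
    ∃ (φ : ℕ → ℕ) (y : H), StrictMono φ ∧
      ∀ z, Tendsto (fun n => inner ℝ (x (φ n)) z) atTop (𝓝 (inner ℝ y z)) := by
  let T : ℕ → WeakDual ℝ H := fun n =>
    WeakDual.toStrongDual.symm (InnerProductSpace.toDual ℝ H (x n))
  obtain ⟨ℓ, -, φ, hφ, h_lim⟩ := WeakDual.isSeqCompact_closedBall ℝ H 0 C (x := T) fun n => by
    rw [Set.mem_preimage, mem_closedBall_zero_iff]
    simpa only [T, LinearEquiv.apply_symm_apply, LinearIsometryEquiv.norm_map] using hx n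
  refine ⟨φ, (InnerProductSpace.toDual ℝ H).symm (WeakDual.toStrongDual ℓ), hφ, fun z => ?_⟩
  rw [InnerProductSpace.toDual_symm_apply]
  exact ((WeakDual.eval_continuous (𝕜 := ℝ) z).tendsto ℓ).comp h_lim

theorem tendsto_of_forall_inner {ι F : Type*} [NormedAddCommGroup F] [InnerProductSpace ℝ F]
    [ProperSpace F] {l : Filter ι} {z : ι → F} {c : F}
    (h : ∀ a, Tendsto (fun i => inner ℝ a (z i)) l (𝓝 (inner ℝ a c))) : Tendsto z l (𝓝 c) := by
  have : FiniteDimensional ℝ F := FiniteDimensional.of_locallyCompactSpace ℝ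
  let b := stdOrthonormalBasis ℝ F
  have h_sum := tendsto_finsetSum Finset.univ fun j _ => (h (b j)).smul_const (b j)
  simpa only [b.sum_repr'] using h_sum

variable {α F : Type*} [MeasurableSpace α] {μ : Measure α} [NormedAddCommGroup F]
  [InnerProductSpace ℝ F] {G G' : ℕ → α → F} {f g h : α → F}

theorem integrable_inner_of_memLp (hf : MemLp f 2 μ) (hg : MemLp g 2 μ) :
    Integrable (fun x => inner ℝ (f x) (g x)) μ :=
  (integrable_norm_mul_norm hf hg).mono' (hf.1.inner hg.1)
    (Eventually.of_forall fun _ => norm_inner_le_norm _ _)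

theorem norm_integral_inner_le (hf : MemLp f 2 μ) (hg : MemLp g 2 μ) :
    ‖∫ x, inner ℝ (f x) (g x) ∂μ‖ ≤ √(∫ x, ‖f x‖ ^ 2 ∂μ) * √(∫ x, ‖g x‖ ^ 2 ∂μ) :=
  ((norm_integral_le_integral_norm _).trans (integral_mono_of_nonneg
    (Eventually.of_forall fun _ => norm_nonneg _) (integrable_norm_mul_norm hf hg)
    (Eventually.of_forall fun _ => norm_inner_le_norm _ _))).trans (integral_norm_mul_norm_le hf hg)

theorem inner_toLp_toLp (hf : MemLp f 2 μ) (hg : MemLp g 2 μ) :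
    inner ℝ (hf.toLp f) (hg.toLp g) = ∫ x, inner ℝ (f x) (g x) ∂μ := by
  rw [L2.inner_def]
  refine integral_congr_ae ?_
  filter_upwards [hf.coeFn_toLp, hg.coeFn_toLp] with x hx hx'
  rw [hx, hx']

/-- Weak convergence `G n ⇀ g` in `L²(μ)`, tested against the functions of `L²(μ)`. -/
def TendstoWeakL2 (μ : Measure α) (G : ℕ → α → F) (g : α → F) : Prop :=
  ∀ h, MemLp h 2 μ →
    Tendsto (fun n => ∫ x, inner ℝ (h x) (G n x) ∂μ) atTop (𝓝 (∫ x, inner ℝ (h x) (g x) ∂μ))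

theorem exists_subseq_tendstoWeakL2 [CompleteSpace F] [TopologicalSpace.SeparableSpace F]
    [IsSeparable μ] {D : ℝ} (hG : ∀ n, MemLp (G n) 2 μ) (hD : ∀ n, ∫ x, ‖G n x‖ ^ 2 ∂μ ≤ D) :
    ∃ (φ : ℕ → ℕ) (g : α → F), StrictMono φ ∧ MemLp g 2 μ ∧
      TendstoWeakL2 μ (fun n => G (φ n)) g := by
  have : Fact ((2 : ENNReal) ≠ ⊤) := ⟨by simp⟩
  obtain ⟨φ, g, hφ, h_weak⟩ := exists_subseq_tendsto_inner (x := fun n => (hG n).toLp (G n))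
    (C := √D) fun n => by
      refine Real.le_sqrt_of_sq_le ?_
      rw [← real_inner_self_eq_norm_sq, inner_toLp_toLp]
      simpa only [real_inner_self_eq_norm_sq] using hD n
  refine ⟨φ, g, hφ, Lp.memLp g, fun h hh => ?_⟩
  rw [← inner_toLp_toLp hh (Lp.memLp g), Lp.toLp_coeFn, real_inner_comm]
  refine (h_weak (hh.toLp h)).congr fun n => ?_
  rw [real_inner_comm, inner_toLp_toLp]

namespace TendstoWeakL2

theorem restrict (h_weak : TendstoWeakL2 μ G g) {A : Set α} (hA : MeasurableSet A) :
    TendstoWeakL2 (μ.restrict A) G g := by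
  have h_indicator : ∀ h f : α → F, ∫ x, inner ℝ (A.indicator h x) (f x) ∂μ
      = ∫ x in A, inner ℝ (h x) (f x) ∂μ := fun h f => by
    rw [← integral_indicator hA]
    congr with x
    by_cases hx : x ∈ A <;> simp [hx]
  intro h hh
  simpa only [h_indicator] using h_weak _ ((memLp_indicator_iff_restrict hA).mpr hh)

theorem tendsto_integral [ProperSpace F] [IsFiniteMeasure μ] (h_weak : TendstoWeakL2 μ G g)
    (hG : ∀ n, MemLp (G n) 2 μ) (hg : MemLp g 2 μ) :
    Tendsto (fun n => ∫ x, G n x ∂μ) atTop (𝓝 (∫ x, g x ∂μ)) := by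
  refine tendsto_of_forall_inner fun a => ?_
  rw [← integral_inner (hg.integrable one_le_two)]
  exact (h_weak _ (memLp_const a)).congr fun n => integral_inner ((hG n).integrable one_le_two) a

theorem tendsto_integral_inner (h_weak : TendstoWeakL2 μ G g) (hG : ∀ n, MemLp (G n) 2 μ) {D : ℝ}
    (hD : ∀ n, ∫ x, ‖G n x‖ ^ 2 ∂μ ≤ D) (hG' : ∀ n, MemLp (G' n) 2 μ) (hh : MemLp h 2 μ)
    (h_strong : Tendsto (fun n => ∫ x, ‖G' n x - h x‖ ^ 2 ∂μ) atTop (𝓝 0)) :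
    Tendsto (fun n => ∫ x, inner ℝ (G' n x) (G n x) ∂μ) atTop
      (𝓝 (∫ x, inner ℝ (h x) (g x) ∂μ)) := by
  have h_err : Tendsto (fun n => ∫ x, inner ℝ (G' n x - h x) (G n x) ∂μ) atTop (𝓝 0) := by
    refine squeeze_zero_norm (a := fun n => √(∫ x, ‖G' n x - h x‖ ^ 2 ∂μ) * √D) (fun n => ?_)
      (by simpa using h_strong.sqrt.mul_const √D)
    refine (norm_integral_inner_le ((hG' n).sub hh) (hG n)).trans ?_
    exact mul_le_mul_of_nonneg_left (Real.sqrt_le_sqrt (hD n)) (Real.sqrt_nonneg _)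
  have h_sum := h_err.add (h_weak h hh)
  rw [zero_add] at h_sum
  refine h_sum.congr fun n => ?_
  have h_diff : MemLp (fun x => G' n x - h x) 2 μ := (hG' n).sub hh
  rw [← integral_add (integrable_inner_of_memLp h_diff (hG n))
    (integrable_inner_of_memLp hh (hG n))]
  simp only [inner_sub_left, sub_add_cancel]

end TendstoWeakL2

end Weak

end Limits

section WeakLimits

/-! ### Weak limits in `H¹` -/

variable {F : Type*} [NormedAddCommGroup F] [InnerProductSpace ℝ F]

/-- The pairs `(v n, G n)` are bounded in `H¹` by `B` and `D` and converge to the pair `(w, g)`: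
pointwise on the level of functions, weakly in `L²` on the level of derivatives. -/
structure WeakLimit (v G : ℕ → ℝ → F) (w g : ℝ → F) (B D : ℝ) : Prop where
  pair : ∀ n, H1Pair (v n) (G n)
  pair_limit : H1Pair w g
  bound : ∀ n x, ‖v n x‖ ≤ B
  bound_deriv : ∀ n, ∫ x, ‖G n x‖ ^ 2 ≤ D
  tendsto : ∀ x, Tendsto (fun n => v n x) atTop (𝓝 (w x))
  weak : TendstoWeakL2 volume G g

section Existence

variable [ProperSpace F] {v G : ℕ → ℝ → F} {g : ℝ → F}

theorem tendsto_of_tendstoWeakL2_deriv (hv : ∀ n, H1Pair (v n) (G n)) (hg : MemLp g 2)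
    (h_weak : TendstoWeakL2 volume G g) {c : F} (hc : Tendsto (fun n => v n 0) atTop (𝓝 c))
    (x : ℝ) : Tendsto (fun n => v n x) atTop (𝓝 (c + ∫ t in 0..x, g t)) := by
  have h_int : Tendsto (fun n => ∫ t in 0..x, G n t) atTop (𝓝 (∫ t in 0..x, g t)) := by
    have : IsFiniteMeasure (volume.restrict (Set.uIoc 0 x)) := by
      unfold Set.uIoc; infer_instance
    have h_uIoc := (h_weak.restrict (measurableSet_uIoc (a := 0) (b := x))).tendsto_integral
      (fun n => (hv n).memLp_deriv.restrict _) (hg.restrict _)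
    simpa only [intervalIntegral.intervalIntegral_eq_integral_uIoc] using h_uIoc.const_smul _
  exact (hc.add h_int).congr fun n => (congrFun ((hv n).eq_add_integral 0) x).symm

theorem exists_weakLimit {M D : ℝ} (hv : ∀ n, H1Pair (v n) (G n))
    (hM : ∀ n, ∫ x, ‖v n x‖ ^ 2 ≤ M) (hD : ∀ n, ∫ x, ‖G n x‖ ^ 2 ≤ D) :
    ∃ (φ : ℕ → ℕ) (w g : ℝ → F) (B : ℝ), StrictMono φ ∧
      WeakLimit (fun n => v (φ n)) (fun n => G (φ n)) w g B D := by
  have hB : ∀ n x, ‖v n x‖ ≤ √(2 * (√M * √D)) := fun n x => by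
    refine Real.le_sqrt_of_sq_le (((hv n).norm_sq_le x).trans ?_)
    gcongr
    exacts [hM n, hD n]
  obtain ⟨φ₁, g, hφ₁, hg, h_weak⟩ :=
    exists_subseq_tendstoWeakL2 (fun n => (hv n).memLp_deriv) hD
  obtain ⟨c, -, φ₂, hφ₂, hc⟩ := (isCompact_closedBall (0 : F) _).tendsto_subseq
    (x := fun n => v (φ₁ n) 0) fun n => mem_closedBall_zero_iff.mpr (hB _ 0)
  have h_weak' : TendstoWeakL2 volume (fun n => G (φ₁ (φ₂ n))) g := fun h hh =>
    (h_weak h hh).comp hφ₂.tendsto_atTop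
  have h_lim := tendsto_of_tendstoWeakL2_deriv (fun n => hv (φ₁ (φ₂ n))) hg h_weak' hc
  have hw : IsPrimitive (fun x => c + ∫ t in 0..x, g t) g :=
    (isPrimitive_integral (hg.locallyIntegrable one_le_two) 0).const_add c
  obtain ⟨hw_sq, -⟩ := integrable_and_integral_norm_le_of_tendsto
    (fun n => (hv (φ₁ (φ₂ n))).integrable_sq)
    (Eventually.of_forall fun x => (h_lim x).norm.pow 2) (C := M) fun n => by simpa using hM _
  exact ⟨φ₁ ∘ φ₂, _, g, _, hφ₁.comp hφ₂, fun n => hv _,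
    ⟨hw, (memLp_two_iff_integrable_sq_norm hw.continuous.aestronglyMeasurable).mpr hw_sq, hg⟩,
    fun n => hB _, fun n => hD _, h_lim, h_weak'⟩

end Existence

/-- The polar form of the kinetic density at `(a, b)`, grouped so that the derivative `b'` of the
other argument enters linearly. -/
def kineticPairing (k : ℝ) (a b a' b' : F) : ℝ :=
  inner ℝ (b + (k * (2 * inner ℝ a b)) • a') b'

theorem kineticPairing_self (k : ℝ) (a b : F) :
    kineticPairing k a b a b = 2 * kineticDensity k a b := by
  rw [kineticPairing, kineticDensity, inner_add_left, real_inner_smul_left,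
    real_inner_self_eq_norm_sq]
  ring

theorem half_norm_sub_sq_add_kineticPairing_le {k : ℝ} (hk : 0 ≤ k) (a b a' b' : F) :
    1 / 2 * ‖b' - b‖ ^ 2 + kineticPairing k a b a' b'
      ≤ kineticDensity k a b + kineticDensity k a' b' := by
  have h_sq : 0 ≤ k / 4 * (2 * inner ℝ a' b' - 2 * inner ℝ a b) ^ 2 := by positivity
  rw [norm_sub_sq_real, kineticPairing, inner_add_left, real_inner_smul_left,
    real_inner_comm b' b, kineticDensity, kineticDensity]
  linarith

namespace WeakLimit

variable {v G : ℕ → ℝ → F} {w g : ℝ → F} {B D k : ℝ}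

theorem bound_limit (hW : WeakLimit v G w g B D) (x : ℝ) : ‖w x‖ ≤ B :=
  le_of_tendsto' (hW.tendsto x).norm fun n => hW.bound n x

theorem integral_sq_le {M : ℝ} (hW : WeakLimit v G w g B D) (hM : ∀ n, ∫ x, ‖v n x‖ ^ 2 ≤ M) :
    ∫ x, ‖w x‖ ^ 2 ≤ M := by
  have h_fatou := (integrable_and_integral_norm_le_of_tendsto
    (fun n => (hW.pair n).integrable_sq)
    (Eventually.of_forall fun x => (hW.tendsto x).norm.pow 2)
    (fun n => by simpa using hM n)).2
  simpa using h_fatou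

theorem tendsto_intervalIntegral_comp_norm (hW : WeakLimit v G w g B D) {f : ℝ → ℝ}
    (hf : Continuous f) (s t : ℝ) :
    Tendsto (fun n => ∫ x in s..t, f ‖v n x‖) atTop (𝓝 (∫ x in s..t, f ‖w x‖)) := by
  obtain ⟨C, hC⟩ :=
    (isCompact_Icc (a := (0 : ℝ)) (b := B)).exists_bound_of_continuousOn hf.continuousOn
  exact intervalIntegral.tendsto_integral_filter_of_dominated_convergence (fun _ => C)
    (Eventually.of_forall fun n =>
      (hf.comp (hW.pair n).continuous.norm).aestronglyMeasurable)
    (Eventually.of_forall fun n => Eventually.of_forall fun x _ =>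
      hC _ ⟨norm_nonneg _, hW.bound n x⟩)
    intervalIntegrable_const
    (Eventually.of_forall fun x _ => (hf.tendsto _).comp (hW.tendsto x).norm)

theorem tendsto_integral_norm_smul_sub_sq (hW : WeakLimit v G w g B D) {q : ℝ → ℝ}
    (hq : MemLp q 2) (A : Set ℝ) :
    Tendsto (fun n => ∫ x in A, ‖q x • (v n x - w x)‖ ^ 2) atTop (𝓝 0) := by
  have h_dom := tendsto_integral_of_dominated_convergence (μ := volume.restrict A)
    (F := fun n x => ‖q x • (v n x - w x)‖ ^ 2) (f := fun _ => (0 : ℝ))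
    (fun x => q x ^ 2 * (2 * B) ^ 2)
    (fun n => ((hq.1.restrict.smul
      ((hW.pair n).continuous.sub hW.pair_limit.continuous).aestronglyMeasurable).norm.pow 2))
    (hq.integrable_sq.restrict.mul_const _) (fun n => Eventually.of_forall fun x => ?_)
    (Eventually.of_forall fun x => ?_)
  · simpa using h_dom
  · have h_diff : ‖v n x - w x‖ ≤ 2 * B := by
      linarith [norm_sub_le (v n x) (w x), hW.bound n x, hW.bound_limit x]
    rw [Real.norm_of_nonneg (by positivity), norm_smul, mul_pow, Real.norm_eq_abs, sq_abs]
    gcongr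
  · simpa using (((hW.tendsto x).sub_const (w x)).const_smul (q x)).norm.pow 2

theorem tendsto_integral_sub_sq (hW : WeakLimit v G w g B D)
    (hm : ∀ n, ∫ x, ‖v n x‖ ^ 2 = ∫ x, ‖w x‖ ^ 2) :
    Tendsto (fun n => ∫ x, ‖v n x - w x‖ ^ 2) atTop (𝓝 0) := by
  have hw_sq := hW.pair_limit.integrable_sq.const_mul 2
  have h_lim := tendsto_integral_of_tendsto_bounds (F := fun _ => (0 : ℝ))
    (fun n => ((hW.pair n).sub hW.pair_limit).integrable_sq.aestronglyMeasurable)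
    (fun n => ((hW.pair n).integrable_sq.const_mul 2).add hw_sq) (hw_sq.add hw_sq)
    (fun n => Eventually.of_forall fun x => ?_) (Eventually.of_forall fun x => ?_)
    (Eventually.of_forall fun x => (((hW.tendsto x).norm.pow 2).const_mul 2).add_const _) ?_
  · simpa using h_lim
  · rw [Real.norm_of_nonneg (by positivity), Pi.add_apply, ← mul_add]
    exact (pow_le_pow_left₀ (norm_nonneg _) (norm_sub_le _ _) 2).trans (add_sq_le)
  · simpa using ((hW.tendsto x).sub_const (w x)).norm.pow 2
  · refine tendsto_const_nhds.congr fun n => ?_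
    rw [integral_add' hw_sq hw_sq,
      integral_add' ((hW.pair n).integrable_sq.const_mul 2) hw_sq, integral_const_mul,
      integral_const_mul, hm n]

variable [CompleteSpace F]

theorem memLp_add_smul (hW : WeakLimit v G w g B D) (k : ℝ) {u h : ℝ → F} (hu : H1Pair u h)
    (hB : ∀ x, ‖u x‖ ≤ B) : MemLp (fun x => g x + (k * (2 * inner ℝ (w x) (g x))) • u x) 2 :=
  hW.pair_limit.memLp_deriv.add (hu.memLp_smul hB (hW.pair_limit.memLp_inner.const_mul k))

theorem tendsto_integral_kineticPairing (hW : WeakLimit v G w g B D) (k : ℝ) {A : Set ℝ}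
    (hA : MeasurableSet A) :
    Tendsto (fun n => ∫ x in A, kineticPairing k (w x) (g x) (v n x) (G n x)) atTop
      (𝓝 (2 * ∫ x in A, kineticDensity k (w x) (g x))) := by
  have h_strong := hW.tendsto_integral_norm_smul_sub_sq (hW.pair_limit.memLp_inner.const_mul k) A
  have h_lim := (hW.weak.restrict hA).tendsto_integral_inner
    (fun n => (hW.pair n).memLp_deriv.restrict A)
    (fun n => (setIntegral_le_integral (hW.pair n).integrable_deriv_sq
      (Eventually.of_forall fun _ => by positivity)).trans (hW.bound_deriv n))
    (fun n => (hW.memLp_add_smul k (hW.pair n) (hW.bound n)).restrict A)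
    ((hW.memLp_add_smul k hW.pair_limit hW.bound_limit).restrict A)
    (by simpa only [add_sub_add_left_eq_sub, ← smul_sub] using h_strong)
  rw [← integral_const_mul]
  simp only [← kineticPairing_self]
  exact h_lim

theorem exists_add_kineticEnergy_le (hW : WeakLimit v G w g B D) (hk : 0 ≤ k) {A : Set ℝ}
    (hA : MeasurableSet A) :
    ∃ e : ℕ → ℝ, Tendsto e atTop (𝓝 0) ∧ ∀ n,
      1 / 2 * (∫ x in A, ‖G n x - g x‖ ^ 2) + (∫ x in A, kineticDensity k (w x) (g x)) + e n
        ≤ ∫ x in A, kineticDensity k (v n x) (G n x) := by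
  refine ⟨fun n => (∫ x in A, kineticPairing k (w x) (g x) (v n x) (G n x))
    - 2 * ∫ x in A, kineticDensity k (w x) (g x), ?_, fun n => ?_⟩
  · rw [← sub_self (2 * ∫ x in A, kineticDensity k (w x) (g x))]
    exact (hW.tendsto_integral_kineticPairing k hA).sub_const _
  have h_sq : IntegrableOn (fun x => 1 / 2 * ‖G n x - g x‖ ^ 2) A :=
    (((hW.pair n).sub hW.pair_limit).integrable_deriv_sq.const_mul _).integrableOn
  have h_pairing : IntegrableOn (fun x => kineticPairing k (w x) (g x) (v n x) (G n x)) A :=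
    (integrable_inner_of_memLp (hW.memLp_add_smul k (hW.pair n) (hW.bound n))
      (hW.pair n).memLp_deriv).integrableOn
  have h_kin := (hW.pair_limit.integrable_kineticDensity k).integrableOn (s := A)
  have h_kin' := ((hW.pair n).integrable_kineticDensity k).integrableOn (s := A)
  have h_le := integral_mono (h_sq.add h_pairing) (h_kin.add h_kin') fun x =>
    half_norm_sub_sq_add_kineticPairing_le hk (w x) (g x) (v n x) (G n x)
  rw [integral_add' h_sq h_pairing, integral_add' h_kin h_kin', integral_const_mul] at h_le
  linarith

end WeakLimit

end WeakLimits

section Compactness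

/-! ### The action of the weak limit -/

theorem exists_seq_tendsto_zero_of_integrable {f : ℝ → ℝ} (hf : Integrable f) (hf0 : ∀ x, 0 ≤ f x) :
    ∃ R : ℕ → ℝ, Tendsto R atTop atTop ∧ Tendsto (fun n => f (R n)) atTop (𝓝 0) := by
  choose R hR hfR using fun n : ℕ =>
    exists_ge_lt_of_integrable hf (ε := 1 / ((n : ℝ) + 1)) (by positivity) n
  exact ⟨R, tendsto_atTop_mono hR tendsto_natCast_atTop_atTop,
    squeeze_zero (fun n => hf0 _) (fun n => (hfR n).le) tendsto_one_div_add_atTop_nhds_zero_nat⟩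

theorem integral_eq_add_three {f : ℝ → ℝ} (hf : Integrable f) (s t : ℝ) :
    ∫ x, f x = (∫ x in Set.Iic s, f x) + (∫ x in s..t, f x) + ∫ x in Set.Ioi t, f x := by
  rw [← intervalIntegral.integral_Iic_sub_Iic hf.integrableOn hf.integrableOn, add_sub_cancel,
    intervalIntegral.integral_Iic_add_Ioi hf.integrableOn hf.integrableOn]

variable {k θ p M ν : ℝ}

section Action

variable {F : Type*} [NormedAddCommGroup F] [InnerProductSpace ℝ F] [CompleteSpace F]

theorem H1Pair.intervalIntegral_actionDensity {u h : ℝ → F} (hu : H1Pair u h) (hp : 2 ≤ p)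
    {s t : ℝ} (hst : s ≤ t) :
    ∫ x in s..t, actionDensity k θ p ν (u x) (h x)
      = (∫ x in Set.Ioc s t, kineticDensity k (u x) (h x))
        - ∫ x in s..t, (θ / p * ‖u x‖ ^ p + ν * ‖u x‖ ^ 2) := by
  have h_pot : Integrable (fun x => θ / p * ‖u x‖ ^ p + ν * ‖u x‖ ^ 2) :=
    ((hu.integrable_rpow hp).const_mul _).add (hu.integrable_sq.const_mul _)
  rw [← intervalIntegral.integral_of_le hst, ← intervalIntegral.integral_sub
    (hu.integrable_kineticDensity k).intervalIntegrable h_pot.intervalIntegrable]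
  simp only [actionDensity, sub_sub]

namespace WeakLimit

variable {v G : ℕ → ℝ → F} {w g : ℝ → F} {B D : ℝ}

theorem exists_add_action_le (hW : WeakLimit v G w g B D) (hk : 0 ≤ k) (hp : 2 ≤ p) {s t : ℝ}
    (hst : s ≤ t) :
    ∃ e : ℕ → ℝ, Tendsto e atTop (𝓝 0) ∧ ∀ n,
      (∫ x in s..t, actionDensity k θ p ν (w x) (g x)) + e n
        ≤ ∫ x in s..t, actionDensity k θ p ν (v n x) (G n x) := by
  obtain ⟨e, he, h_le⟩ := hW.exists_add_kineticEnergy_le hk (measurableSet_Ioc (a := s) (b := t))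
  have h_pot := hW.tendsto_intervalIntegral_comp_norm
    (f := fun r => θ / p * r ^ p + ν * r ^ 2)
    ((continuous_const.mul (continuous_id.rpow_const fun _ => Or.inr (by linarith))).add
      (by fun_prop)) s t
  refine ⟨fun n => e n - ((∫ x in s..t, (θ / p * ‖v n x‖ ^ p + ν * ‖v n x‖ ^ 2))
    - ∫ x in s..t, (θ / p * ‖w x‖ ^ p + ν * ‖w x‖ ^ 2)), ?_, fun n => ?_⟩
  · simpa only [sub_zero] using he.sub (tendsto_sub_nhds_zero_iff.mpr h_pot)
  · rw [hW.pair_limit.intervalIntegral_actionDensity hp hst,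
      (hW.pair n).intervalIntegral_actionDensity hp hst]
    have h_sq : 0 ≤ ∫ x in Set.Ioc s t, ‖G n x - g x‖ ^ 2 := integral_nonneg fun _ => by positivity
    linarith [h_le n]

/-- Passes to the limit in the splitting of the action of `v n` at `s` and `t`: the middle part is
weakly lower semicontinuous and the outer parts are bounded below by boundary terms. -/
theorem intervalIntegral_actionDensity_le (hW : WeakLimit v G w g B D)
    (hν : IsEnergyPerMassBound F k θ p M ν) (hk : 0 ≤ k) (hθ : 0 ≤ θ) (hM : 0 < M) (hp : 2 < p)
    (hm : ∀ n, ∫ x, ‖v n x‖ ^ 2 = M)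
    (hE : Tendsto (fun n => pairEnergy k θ p (v n) (G n)) atTop (𝓝 (ν * M))) {s t : ℝ}
    (hst : s ≤ t) (h_mid : (‖w s‖ ^ 2 + ‖w t‖ ^ 2) / 2 < ∫ x in s..t, ‖w x‖ ^ 2) :
    ∫ x in s..t, actionDensity k θ p ν (w x) (g x)
      ≤ (1 / 2 + k * B ^ 2 - ν) * ((‖w s‖ ^ 2 + ‖w t‖ ^ 2) / 2) := by
  obtain ⟨e, he, h_le⟩ := hW.exists_add_action_le (θ := θ) (ν := ν) hk hp.le hst
  have h_ends : Tendsto (fun n => (‖v n s‖ ^ 2 + ‖v n t‖ ^ 2) / 2) atTop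
      (𝓝 ((‖w s‖ ^ 2 + ‖w t‖ ^ 2) / 2)) :=
    (((hW.tendsto s).norm.pow 2).add ((hW.tendsto t).norm.pow 2)).div_const 2
  have h_mass_mid : ∀ᶠ n in atTop, (‖v n s‖ ^ 2 + ‖v n t‖ ^ 2) / 2 < ∫ x in s..t, ‖v n x‖ ^ 2 :=
    h_ends.eventually_lt (hW.tendsto_intervalIntegral_comp_norm (continuous_pow 2) s t) h_mid
  have h_action : Tendsto (fun n => ∫ x, actionDensity k θ p ν (v n x) (G n x)) atTop (𝓝 0) := by
    rw [← sub_self (ν * M)]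
    refine (hE.sub_const (ν * M)).congr fun n => ?_
    rw [(hW.pair n).integral_actionDensity hp.le, hm n]
  rw [← sub_nonpos]
  refine le_of_tendsto_of_tendsto (f := fun n =>
    (∫ x in s..t, actionDensity k θ p ν (w x) (g x)) + e n
      - (1 / 2 + k * B ^ 2 - ν) * ((‖v n s‖ ^ 2 + ‖v n t‖ ^ 2) / 2))
    (by simpa using (he.const_add _).sub (h_ends.const_mul _)) h_action ?_
  filter_upwards [h_mass_mid] with n hn
  have h_mass := integral_eq_add_three (hW.pair n).integrable_sq s t
  rw [hm n] at h_mass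
  have h_left : 0 ≤ ∫ x in Set.Iic s, ‖v n x‖ ^ 2 := integral_nonneg fun _ => by positivity
  have h_right : 0 ≤ ∫ x in Set.Ioi t, ‖v n x‖ ^ 2 := integral_nonneg fun _ => by positivity
  have h_Iic := hν.le_action_Iic hk hθ hM hp (hW.pair n) (hW.bound n s)
    (by linarith [sq_nonneg ‖v n t‖])
  have h_Ioi := hν.le_action_Ioi hk hθ hM hp (hW.pair n) (hW.bound n t)
    (by linarith [sq_nonneg ‖v n s‖])
  rw [integral_eq_add_three ((hW.pair n).integrable_actionDensity hp.le) s t]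
  linarith [h_le n]

theorem action_nonpos (hW : WeakLimit v G w g B D) (hν : IsEnergyPerMassBound F k θ p M ν)
    (hk : 0 ≤ k) (hθ : 0 ≤ θ) (hM : 0 < M) (hp : 2 < p) (hm : ∀ n, ∫ x, ‖v n x‖ ^ 2 = M)
    (hE : Tendsto (fun n => pairEnergy k θ p (v n) (G n)) atTop (𝓝 (ν * M))) {x₀ : ℝ}
    (hx₀ : w x₀ ≠ 0) : ∫ x, actionDensity k θ p ν (w x) (g x) ≤ 0 := by
  have hw := hW.pair_limit
  obtain ⟨R, hR, h_ends⟩ := exists_seq_tendsto_zero_of_integrable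
    (hw.reflect.integrable_sq.add hw.integrable_sq) fun x => add_nonneg (sq_nonneg _) (sq_nonneg _)
  replace h_ends : Tendsto (fun j => (‖w (-R j)‖ ^ 2 + ‖w (R j)‖ ^ 2) / 2) atTop (𝓝 0) := by
    simpa using h_ends.div_const 2
  have h_exhaust : ∀ {f : ℝ → ℝ}, Integrable f →
      Tendsto (fun j => ∫ x in (-R j)..(R j), f x) atTop (𝓝 (∫ x, f x)) := fun hf =>
    intervalIntegral_tendsto_integral hf (tendsto_neg_atTop_atBot.comp hR) hR
  have h_bound : Tendsto (fun j => (1 / 2 + k * B ^ 2 - ν)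
      * ((‖w (-R j)‖ ^ 2 + ‖w (R j)‖ ^ 2) / 2)) atTop (𝓝 0) := by
    simpa only [mul_zero] using h_ends.const_mul (1 / 2 + k * B ^ 2 - ν)
  have h_mid := h_ends.eventually_lt (h_exhaust hw.integrable_sq) (hw.integral_sq_pos hx₀)
  refine le_of_tendsto_of_tendsto (h_exhaust (hw.integrable_actionDensity hp.le)) h_bound ?_
  filter_upwards [h_mid, hR.eventually_ge_atTop 0] with j hj hRj
  exact hW.intervalIntegral_actionDensity_le hν hk hθ hM hp hm hE (by linarith) hj

theorem tendsto_integral_rpow (hW : WeakLimit v G w g B D) (hp : 2 ≤ p)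
    (hm : ∀ n, ∫ x, ‖v n x‖ ^ 2 = ∫ x, ‖w x‖ ^ 2) :
    Tendsto (fun n => ∫ x, ‖v n x‖ ^ p) atTop (𝓝 (∫ x, ‖w x‖ ^ p)) := by
  refine tendsto_integral_of_tendsto_bounds
    (fun n => ((hW.pair n).integrable_rpow hp).aestronglyMeasurable)
    (fun n => (hW.pair n).integrable_sq.const_mul (B ^ (p - 2)))
    (hW.pair_limit.integrable_sq.const_mul (B ^ (p - 2)))
    (fun n => Eventually.of_forall fun x => ?_)
    (Eventually.of_forall fun x => (hW.tendsto x).norm.rpow_const (Or.inr (by linarith)))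
    (Eventually.of_forall fun x => ((hW.tendsto x).norm.pow 2).const_mul _) ?_
  · rw [Real.norm_of_nonneg (by positivity)]
    exact rpow_le_rpow_sub_two_mul_sq hp (norm_nonneg _) (hW.bound n x)
  · simp only [integral_const_mul, hm]
    exact tendsto_const_nhds

theorem tendsto_integral_deriv_sub_sq (hW : WeakLimit v G w g B D) (hk : 0 ≤ k) (hp : 2 ≤ p)
    (hm : ∀ n, ∫ x, ‖v n x‖ ^ 2 = ∫ x, ‖w x‖ ^ 2)
    (hE : Tendsto (fun n => pairEnergy k θ p (v n) (G n)) atTop (𝓝 (pairEnergy k θ p w g))) :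
    Tendsto (fun n => ∫ x, ‖G n x - g x‖ ^ 2) atTop (𝓝 0) := by
  obtain ⟨e, he, h_le⟩ := hW.exists_add_kineticEnergy_le hk MeasurableSet.univ
  simp only [Measure.restrict_univ] at h_le
  have h_kin : Tendsto (fun n => kineticEnergy k (v n) (G n)) atTop (𝓝 (kineticEnergy k w g)) := by
    simpa only [pairEnergy, sub_add_cancel]
      using hE.add ((hW.tendsto_integral_rpow hp hm).const_mul (θ / p))
  refine squeeze_zero (fun n => integral_nonneg fun _ => by positivity) (fun n => ?_)
    (g := fun n => 2 * (kineticEnergy k (v n) (G n) - kineticEnergy k w g - e n)) ?_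
  · unfold kineticEnergy
    linarith [h_le n]
  · simpa using ((h_kin.sub_const (kineticEnergy k w g)).sub he).const_mul 2

theorem mass_eq_and_energy_eq (hW : WeakLimit v G w g B D)
    (hν : IsEnergyPerMassBound F k θ p M ν) (hk : 0 ≤ k) (hθ : 0 ≤ θ) (hM : 0 < M) (hp : 2 < p)
    (hm : ∀ n, ∫ x, ‖v n x‖ ^ 2 = M)
    (hE : Tendsto (fun n => pairEnergy k θ p (v n) (G n)) atTop (𝓝 (ν * M))) {x₀ : ℝ}
    (hx₀ : w x₀ ≠ 0) : ∫ x, ‖w x‖ ^ 2 = M ∧ pairEnergy k θ p w g = ν * M := by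
  have hw := hW.pair_limit
  have h_action := hW.action_nonpos hν hk hθ hM hp hm hE hx₀
  have h_mass : ∫ x, ‖w x‖ ^ 2 = M := le_antisymm (hW.integral_sq_le fun n => (hm n).le)
    (hν.le_mass_of_action_nonpos hM hp hw (hw.kineticEnergy_pos hk hx₀) h_action)
  rw [hw.integral_actionDensity hp.le, h_mass, sub_nonpos] at h_action
  exact ⟨h_mass, h_action.antisymm (hν w g hw h_mass)⟩

end WeakLimit

end Action

theorem exists_norm_ge_of_pairEnergy_le (F : Type*) [NormedAddCommGroup F] [InnerProductSpace ℝ F]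
    [CompleteSpace F] (hk : 0 ≤ k) (hθ : 0 ≤ θ) (hp : 2 < p) (M : ℝ) {E : ℝ} (hE : E < 0) :
    ∃ δ > 0, ∀ u g : ℝ → F, H1Pair u g → ∫ x, ‖u x‖ ^ 2 = M → pairEnergy k θ p u g ≤ E →
      ∃ x, δ ≤ ‖u x‖ := by
  obtain ⟨δ, hδ0, -, hδ⟩ := exists_mul_rpow_lt (A := θ / p * M) (neg_pos.mpr hE)
    (sub_pos.mpr hp)
  refine ⟨δ, hδ0, fun u g hu hm hle => ?_⟩
  by_contra! h_small
  have h_pot : θ / p * ∫ x, ‖u x‖ ^ p ≤ θ / p * M * δ ^ (p - 2) := by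
    rw [mul_assoc, mul_comm M, ← hm]
    gcongr
    exact hu.integral_rpow_le hp.le fun x => (h_small x).le
  have h_kin := kineticEnergy_nonneg hk u g
  rw [pairEnergy] at hle
  linarith

variable {F : Type*} [NormedAddCommGroup F] [InnerProductSpace ℝ F] [ProperSpace F]
  {v G : ℕ → ℝ → F}

theorem exists_translate_weakLimit (hk : 0 ≤ k) (hθ : 0 ≤ θ) (hM : 0 ≤ M) (hp2 : 2 < p)
    (hp6 : p < 6) (hv : ∀ n, H1Pair (v n) (G n)) (hm : ∀ n, ∫ x, ‖v n x‖ ^ 2 = M) {E : ℝ}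
    (hE0 : E < 0) (hE : Tendsto (fun n => pairEnergy k θ p (v n) (G n)) atTop (𝓝 E)) :
    ∃ (φ : ℕ → ℕ) (y : ℕ → ℝ) (w g : ℝ → F) (B D : ℝ), StrictMono φ ∧
      WeakLimit (fun n x => v (φ n) (x + y n)) (fun n x => G (φ n) (x + y n)) w g B D ∧
      w 0 ≠ 0 := by
  obtain ⟨C, hC⟩ := exists_integral_deriv_sq_le_pairEnergy_add F hk hθ hM hp2.le hp6
  obtain ⟨E', hE'⟩ := hE.bddAbove_range
  obtain ⟨δ, hδ, h_large⟩ := exists_norm_ge_of_pairEnergy_le F hk hθ hp2 M (by linarith : E / 2 < 0)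
  have h_event : ∀ᶠ n in atTop, ∃ y, δ ≤ ‖v n y‖ :=
    (hE.eventually_lt_const (by linarith : E < E / 2)).mono fun n hn =>
      h_large _ _ (hv n) (hm n) hn.le
  obtain ⟨y, hy⟩ := h_event.choice
  obtain ⟨φ, w, g, B, hφ, hW⟩ := exists_weakLimit (fun n => (hv n).translate (y n)) (M := M)
    (D := 4 * (E' + C))
    (fun n => by rw [integral_add_right_eq_self (fun x => ‖v n x‖ ^ 2), hm n])
    fun n => by
      rw [integral_add_right_eq_self (fun x => ‖G n x‖ ^ 2)]
      linarith [hC _ _ (hv n) (hm n), hE' ⟨n, rfl⟩]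
  refine ⟨φ, fun n => y (φ n), w, g, B, _, hφ, hW, norm_pos_iff.mp (hδ.trans_le ?_)⟩
  exact ge_of_tendsto (hW.tendsto 0).norm
    ((hφ.tendsto_atTop.eventually hy).mono fun n hn => by simpa using hn)

theorem exists_tendsto_minimizer (hν : IsEnergyPerMassBound F k θ p M ν) (hk : 0 ≤ k)
    (hθ : 0 ≤ θ) (hM : 0 < M) (hp2 : 2 < p) (hp6 : p < 6) (hν0 : ν < 0)
    (hv : ∀ n, H1Pair (v n) (G n)) (hm : ∀ n, ∫ x, ‖v n x‖ ^ 2 = M)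
    (hE : Tendsto (fun n => pairEnergy k θ p (v n) (G n)) atTop (𝓝 (ν * M))) :
    ∃ (φ : ℕ → ℕ) (y : ℕ → ℝ) (w g : ℝ → F), StrictMono φ ∧ H1Pair w g ∧
      ∫ x, ‖w x‖ ^ 2 = M ∧ pairEnergy k θ p w g = ν * M ∧
      Tendsto (fun n => ∫ x, ‖v (φ n) (x + y n) - w x‖ ^ 2) atTop (𝓝 0) ∧
      Tendsto (fun n => ∫ x, ‖G (φ n) (x + y n) - g x‖ ^ 2) atTop (𝓝 0) := by
  obtain ⟨φ, y, w, g, B, D, hφ, hW, hw0⟩ := exists_translate_weakLimit hk hθ hM.le hp2 hp6 hv hm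
    (mul_neg_of_neg_of_pos hν0 hM) hE
  have hm' : ∀ n, ∫ x, ‖v (φ n) (x + y n)‖ ^ 2 = M := fun n => by
    rw [integral_add_right_eq_self (fun x => ‖v (φ n) x‖ ^ 2), hm]
  have hE' : Tendsto (fun n => pairEnergy k θ p (fun x => v (φ n) (x + y n))
      (fun x => G (φ n) (x + y n))) atTop (𝓝 (ν * M)) := by
    refine (hE.comp hφ.tendsto_atTop).congr fun n => ?_
    simpa [pairEnergy, one_ne_zero] using
      (pairEnergy_comp k θ p 1 one_ne_zero (y n) (v (φ n)) (G (φ n))).symm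
  obtain ⟨h_mass, h_energy⟩ := hW.mass_eq_and_energy_eq hν hk hθ hM hp2 hm' hE' hw0
  have hm_eq : ∀ n, ∫ x, ‖v (φ n) (x + y n)‖ ^ 2 = ∫ x, ‖w x‖ ^ 2 := fun n => by
    rw [hm', h_mass]
  exact ⟨φ, y, w, g, hφ, hW.pair_limit, h_mass, h_energy, hW.tendsto_integral_sub_sq hm_eq,
    hW.tendsto_integral_deriv_sub_sq hk hp2.le hm_eq (by rwa [h_energy])⟩

end Compactness

section NonnegativeMinimizers

/-! ### Replacing a function by its norm -/

variable {F F' : Type*} [NormedAddCommGroup F] [InnerProductSpace ℝ F] [NormedAddCommGroup F']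
  [InnerProductSpace ℝ F'] {u g : ℝ → F}

theorem H1Pair.map [CompleteSpace F] [CompleteSpace F'] (hu : H1Pair u g) (L : F →L[ℝ] F') :
    H1Pair (fun x => L (u x)) (fun x => L (g x)) where
  locallyIntegrable := (L.comp_memLp' hu.memLp_deriv).locallyIntegrable one_le_two
  sub_eq a b := by
    rw [L.intervalIntegral_comp_comm (hu.intervalIntegrable a b), ← hu.sub_eq, map_sub]
  memLp := L.comp_memLp' hu.memLp
  memLp_deriv := L.comp_memLp' hu.memLp_deriv

theorem pairEnergy_map (k θ p : ℝ) (L : F →ₗᵢ[ℝ] F') (u g : ℝ → F) :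
    pairEnergy k θ p (fun x => L (u x)) (fun x => L (g x)) = pairEnergy k θ p u g := by
  simp only [pairEnergy, kineticEnergy, kineticDensity, L.norm_map, L.inner_map_map]

theorem H1Pair.exists_norm [CompleteSpace F] (hu : H1Pair u g) (k θ p : ℝ) :
    ∃ r : ℝ → ℝ, H1Pair (fun x => ‖u x‖) r ∧
      pairEnergy k θ p (fun x => ‖u x‖) r ≤ pairEnergy k θ p u g := by
  obtain ⟨r, hr, hrg⟩ := hu.toIsPrimitive.exists_norm
  have hn : H1Pair (fun x => ‖u x‖) r :=
    ⟨hr, hu.memLp.norm, hu.memLp_deriv.mono hr.locallyIntegrable.aestronglyMeasurable hrg⟩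
  have h_sq : (fun x => 2 * inner ℝ ‖u x‖ (r x)) =ᵐ[volume] fun x => 2 * inner ℝ (u x) (g x) :=
    IsWeakDeriv.ae_unique (by simpa only [norm_norm] using hr.norm_sq.isWeakDeriv)
      hu.norm_sq.isWeakDeriv
  refine ⟨r, hn, ?_⟩
  simp only [pairEnergy, norm_norm]
  refine sub_le_sub_right (integral_mono_ae (hn.integrable_kineticDensity k)
    (hu.integrable_kineticDensity k) ?_) _
  filter_upwards [h_sq, hrg] with x hx hrgx
  simp only [kineticDensity, hx]
  gcongr

end NonnegativeMinimizers

section MassSphere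

/-! ### The constrained minimization problem -/

variable {k θ p lam : ℝ}

theorem bddBelow_energy (hk : 0 ≤ k) (hθ : 0 ≤ θ) (hlam : 0 ≤ lam) (hp2 : 2 ≤ p) (hp6 : p < 6) :
    BddBelow (energy k θ p '' massSphere lam) := by
  obtain ⟨C, hC⟩ := exists_integral_deriv_sq_le_pairEnergy_add ℂ hk hθ
    (M := 2 * lam) (by positivity) hp2 hp6
  refine ⟨-C, ?_⟩
  rintro _ ⟨v, hv, rfl⟩
  obtain ⟨u, g, hu, hvu, hm⟩ := exists_h1Pair_of_mem_massSphere hv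
  have h_deriv : 0 ≤ ∫ x, ‖g x‖ ^ 2 := integral_nonneg fun _ => by positivity
  rw [hu.energy_eq hvu hp2]
  linarith [hC u g hu hm]

theorem minEnergy_le_pairEnergy (hb : BddBelow (energy k θ p '' massSphere lam)) (hp : 2 ≤ p)
    {u g : ℝ → ℂ} (hu : H1Pair u g) (hm : ∫ x, ‖u x‖ ^ 2 = 2 * lam) :
    minEnergy k θ p lam ≤ pairEnergy k θ p u g :=
  csInf_le hb ⟨u, hu.mem_massSphere (ae_eq_refl u) hm, hu.energy_eq (ae_eq_refl u) hp⟩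

theorem isEnergyPerMassBound_minEnergy (hb : BddBelow (energy k θ p '' massSphere lam))
    (hlam : 0 < lam) (hp : 2 ≤ p) :
    IsEnergyPerMassBound ℂ k θ p (2 * lam) (minEnergy k θ p lam / (2 * lam)) := fun u g hu hm => by
  rw [div_mul_cancel₀ _ (by positivity)]
  exact minEnergy_le_pairEnergy hb hp hu hm

theorem minEnergy_neg (hk : 0 ≤ k) (hθ : 0 < θ) (hlam : 0 < lam) (hp2 : 2 ≤ p) (hp6 : p < 6) :
    minEnergy k θ p lam < 0 := by
  obtain ⟨u, g, hu, hm, hneg⟩ := exists_pairEnergy_neg ℂ hk hθ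
    (M := 2 * lam) (by positivity) hp2 hp6
  exact (minEnergy_le_pairEnergy (bddBelow_energy hk hθ.le hlam.le hp2 hp6) hp2 hu hm).trans_lt hneg

theorem exists_tendsto_minEnergy (hk : 0 ≤ k) (hθ : 0 < θ) (hlam : 0 < lam) (hp2 : 2 ≤ p)
    (hp6 : p < 6) :
    ∃ u : ℕ → ℝ → ℂ, (∀ n, u n ∈ massSphere lam) ∧
      Tendsto (fun n => energy k θ p (u n)) atTop (𝓝 (minEnergy k θ p lam)) := by
  have h_nonempty : (energy k θ p '' massSphere lam).Nonempty := by
    obtain ⟨u, g, hu, hm, -⟩ := exists_pairEnergy_neg ℂ hk hθ (M := 2 * lam) (by positivity) hp2 hp6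
    exact ⟨_, u, hu.mem_massSphere (ae_eq_refl u) hm, rfl⟩
  obtain ⟨s, -, hs, hmem⟩ :=
    exists_seq_tendsto_sInf h_nonempty (bddBelow_energy hk hθ.le hlam.le hp2 hp6)
  choose u hu hus using hmem
  exact ⟨u, hu, hs.congr fun n => (hus n).symm⟩

theorem exists_tendsto_h1Norm (hk : 0 ≤ k) (hθ : 0 < θ) (hlam : 0 < lam) (hp2 : 2 < p)
    (hp6 : p < 6) {u : ℕ → ℝ → ℂ} (hu : ∀ n, u n ∈ massSphere lam)
    (hE : Tendsto (fun n => energy k θ p (u n)) atTop (𝓝 (minEnergy k θ p lam))) :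
    ∃ (φ : ℕ → ℕ) (y : ℕ → ℝ) (w : ℝ → ℂ), StrictMono φ ∧ w ∈ massSphere lam ∧
      energy k θ p w = minEnergy k θ p lam ∧
      Tendsto (fun n => h1Norm (fun x => u (φ n) (x + y n) - w x)) atTop (𝓝 0) := by
  choose v G hv huv hm using fun n => exists_h1Pair_of_mem_massSphere (hu n)
  have hM : 0 < 2 * lam := by positivity
  have h_ratio : minEnergy k θ p lam / (2 * lam) * (2 * lam) = minEnergy k θ p lam :=
    div_mul_cancel₀ _ hM.ne'
  obtain ⟨φ, y, w, g, hφ, hw, hw_mass, hw_energy, h_lim, h_lim_deriv⟩ :=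
    exists_tendsto_minimizer
      (isEnergyPerMassBound_minEnergy (bddBelow_energy hk hθ.le hlam.le hp2.le hp6) hlam hp2.le)
      hk hθ.le hM hp2 hp6 (div_neg_of_neg_of_pos (minEnergy_neg hk hθ hlam hp2.le hp6) hM) hv hm
      (by rw [h_ratio]; exact hE.congr fun n => (hv n).energy_eq (huv n) hp2.le)
  have h_ae : ∀ n, (fun x => u (φ n) (x + y n) - w x)
      =ᵐ[volume] fun x => v (φ n) (x + y n) - w x := fun n =>
    ((measurePreserving_add_right volume (y n)).quasiMeasurePreserving.ae_eq_comp
      (huv (φ n))).sub (ae_eq_refl w)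
  refine ⟨φ, y, w, hφ, hw.mem_massSphere (ae_eq_refl w) hw_mass,
    (hw.energy_eq (ae_eq_refl w) hp2.le).trans (hw_energy.trans h_ratio), ?_⟩
  simp only [fun n => (((hv (φ n)).translate (y n)).sub hw).h1Norm_eq (h_ae n)]
  simpa using (h_lim_deriv.add h_lim).sqrt

theorem exists_nonneg_of_isMinimizer (hb : BddBelow (energy k θ p '' massSphere lam))
    (hlam : 0 < lam) (hp : 2 ≤ p) {v : ℝ → ℂ} (hv : v ∈ massSphere lam)
    (hE : energy k θ p v = minEnergy k θ p lam) :
    ∃ w : ℝ → ℝ, (∀ x, 0 ≤ w x) ∧ ¬ (w =ᵐ[volume] 0) ∧ (fun x => (w x : ℂ)) ∈ massSphere lam ∧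
      energy k θ p (fun x => (w x : ℂ)) = minEnergy k θ p lam := by
  obtain ⟨u, g, hu, hvu, hm⟩ := exists_h1Pair_of_mem_massSphere hv
  obtain ⟨r, hr, hle⟩ := hu.exists_norm k θ p
  have hn : H1Pair (fun x => (‖u x‖ : ℂ)) (fun x => (r x : ℂ)) := hr.map Complex.ofRealCLM
  have hn_mass : ∫ x, ‖(‖u x‖ : ℂ)‖ ^ 2 = 2 * lam := by
    simpa only [Complex.norm_real, norm_norm] using hm
  refine ⟨fun x => ‖u x‖, fun x => norm_nonneg _, fun h_zero => ?_,
    hn.mem_massSphere (ae_eq_refl _) hn_mass, ?_⟩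
  · have h_mass_zero : ∫ x, ‖u x‖ ^ 2 = 0 :=
      integral_eq_zero_of_ae (h_zero.mono fun x hx => by simpa using hx)
    linarith
  · rw [hn.energy_eq (ae_eq_refl _) hp]
    refine le_antisymm ?_ (minEnergy_le_pairEnergy hb hp hn hn_mass)
    rw [← hE, hu.energy_eq hvu hp]
    exact (pairEnergy_map k θ p Complex.ofRealLI _ _).trans_le hle

theorem exists_nonneg_minimizer (hk : 0 ≤ k) (hθ : 0 < θ) (hlam : 0 < lam) (hp2 : 2 < p)
    (hp6 : p < 6) :
    ∃ w : ℝ → ℝ, (∀ x, 0 ≤ w x) ∧ ¬ (w =ᵐ[volume] 0) ∧ (fun x => (w x : ℂ)) ∈ massSphere lam ∧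
      energy k θ p (fun x => (w x : ℂ)) = minEnergy k θ p lam := by
  obtain ⟨u, hu, hE⟩ := exists_tendsto_minEnergy hk hθ hlam hp2.le hp6
  obtain ⟨-, -, v, -, hv, hv_energy, -⟩ := exists_tendsto_h1Norm hk hθ hlam hp2 hp6 hu hE
  exact exists_nonneg_of_isMinimizer (bddBelow_energy hk hθ.le hlam.le hp2.le hp6) hlam hp2.le hv
    hv_energy

end MassSphere

end QuasilinearNLS

end

theorem proposition4p5_general (k θ p lam : ℝ) (hk : 0 ≤ k) (hθ : 0 < θ) (hlam : 0 < lam)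
    (hp2 : 2 < p) (hp6 : p < 6) :
    BddBelow (QuasilinearNLS.energy k θ p '' QuasilinearNLS.massSphere lam) ∧
    QuasilinearNLS.minEnergy k θ p lam < 0 ∧
    (∃ w : ℝ → ℝ, (∀ x, 0 ≤ w x) ∧ ¬ (w =ᵐ[volume] 0) ∧
      (fun x => (w x : ℂ)) ∈ QuasilinearNLS.massSphere lam ∧
      QuasilinearNLS.energy k θ p (fun x => (w x : ℂ)) = QuasilinearNLS.minEnergy k θ p lam) ∧
    (∀ u : ℕ → ℝ → ℂ, (∀ n, u n ∈ QuasilinearNLS.massSphere lam) →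
      Tendsto (fun n => QuasilinearNLS.energy k θ p (u n)) atTop
        (𝓝 (QuasilinearNLS.minEnergy k θ p lam)) →
      ∃ (φ : ℕ → ℕ) (y : ℕ → ℝ) (w : ℝ → ℂ), StrictMono φ ∧
        w ∈ QuasilinearNLS.massSphere lam ∧
        QuasilinearNLS.energy k θ p w = QuasilinearNLS.minEnergy k θ p lam ∧
        Tendsto (fun n => QuasilinearNLS.h1Norm (fun x => u (φ n) (x + y n) - w x)) atTop
          (𝓝 0)) :=
  ⟨QuasilinearNLS.bddBelow_energy hk hθ.le hlam.le hp2.le hp6,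
    QuasilinearNLS.minEnergy_neg hk hθ hlam hp2.le hp6,
    QuasilinearNLS.exists_nonneg_minimizer hk hθ hlam hp2 hp6,
    fun _ hu hE => QuasilinearNLS.exists_tendsto_h1Norm hk hθ hlam hp2 hp6 hu hE⟩

theorem proposition4p5 (k θ p lam : ℝ) (hk : 0 ≤ k) (hθ : 0 < θ) (hlam : 0 < lam)
    (hp4 : 4 ≤ p) (hp6 : p < 6) :
    -- the infimum `m` is finite and negative
    BddBelow (QuasilinearNLS.energy k θ p '' QuasilinearNLS.massSphere lam) ∧
    QuasilinearNLS.minEnergy k θ p lam < 0 ∧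
    -- it is achieved by a nonzero nonnegative function
    (∃ w : ℝ → ℝ, (∀ x, 0 ≤ w x) ∧ ¬ (w =ᵐ[volume] 0) ∧
      (fun x => (w x : ℂ)) ∈ QuasilinearNLS.massSphere lam ∧
      QuasilinearNLS.energy k θ p (fun x => (w x : ℂ)) = QuasilinearNLS.minEnergy k θ p lam) ∧
    -- up to a subsequence and translations, minimizing sequences converge in `H¹` to a minimizer
    (∀ u : ℕ → ℝ → ℂ, (∀ n, u n ∈ QuasilinearNLS.massSphere lam) →
      Tendsto (fun n => QuasilinearNLS.energy k θ p (u n)) atTop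
        (𝓝 (QuasilinearNLS.minEnergy k θ p lam)) →
      ∃ (φ : ℕ → ℕ) (y : ℕ → ℝ) (w : ℝ → ℂ), StrictMono φ ∧
        w ∈ QuasilinearNLS.massSphere lam ∧
        QuasilinearNLS.energy k θ p w = QuasilinearNLS.minEnergy k θ p lam ∧
        Tendsto (fun n => QuasilinearNLS.h1Norm (fun x => u (φ n) (x + y n) - w x)) atTop
          (𝓝 0)) :=
  proposition4p5_general k θ p lam hk hθ hlam (by linarith) hp6
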